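/- Let $K$ be a real closed field. Then \[ d(K)\;\le\; h^+(K):=\max(|h(K)|^+,\aleph_1), \] where $|h(K)|^+$ is the successor cardinal of the cardinality of $h(K)$, and $d(K)$ (the depth) and $h(K)$ (the height) are defined as follows. A \emph{cut} of a real closed field $F$ is a pair $C=(C^-,C^+)$ of (possibly empty) sets such that $F$ is the disjoint union of $C^-$ and $C^+$, and $x<y$ for all $x\in C^-$, $y\in C^+$. An element $b$ of an ordered field extension $L$ of $F$ \emph{realizes} $C$ if $x<b<y$ for all $x\in C^-$, $y\in C^+$. A set $\mathcal C$ of cuts of $F$ is \emph{independent} if for every $\mathcal C_0\subseteq\mathcal C$, every real closed field $L$ extending $F$ and every choice of realizations $a_C\in L$ of the cuts $C\in\mathcal C_0$, no cut in $\mathcal C\setminus\mathcal C_0$ is realized in the real closure of $F(a_C:C\in\mathcal C_0)$ inside $L$. The \emph{height} $h(K)$ is the least ordinal $\alpha$ for which there is an increasing sequence $(K_i)_{i\le\alpha}$ of real closed subfields of $K$, continuous in the sense that $K_i=\bigcup_{j<i}K_j$ for all limit ordinals $i\le\alpha$, such that $K_0$ is countable, $K_\alpha=K$, and for every $i<\alpha$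 there are an independent set $\mathcal C$ of cuts of $K_i$ and realizations $a_C\in K$ of the cuts $C\in\mathcal C$ (one for each cut) such that $K_{i+1}$ is the real closure of $K_i(a_C:C\in\mathcal C)$ inside $K$. The \emph{depth} $d(K)$ is the least regular (infinite) cardinal $\kappa$ that is greater than the length (an ordinal) of every strictly increasing, ordinal-indexed sequence of elements of $K$. -/

import Mathlib

open Cardinal

universe u

namespace HeightDepth

/-- A cut of a linearly ordered set `F`: a partition of `F` into two sides, the left one lying
below the right one. Either side may be empty. -/
@[ext]
structure Cut (F : Type u) [LinearOrder F] where
  /-- the left side -/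
  lower : Set F
  /-- the right side -/
  upper : Set F
  isCompl : IsCompl lower upper
  lower_lt_upper : ∀ x ∈ lower, ∀ y ∈ upper, x < y

/-- For an embedding `f : F → L`, the element `b` of `L` realizes (fills) the cut `C` of `F` if it
lies strictly between the images of the two sides. -/
def Cut.Realizes {F L : Type u} [LinearOrder F] [LinearOrder L] (f : F → L) (C : Cut F)
    (b : L) : Prop :=
  (∀ x ∈ C.lower, f x < b) ∧ ∀ y ∈ C.upper, b < f y

/-- For a subset `S` of a real closed field `L`, the real closure inside `L` of the subfield
generated by `S`: the elements of `L` that are algebraic over that subfield. -/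
noncomputable def realClosureIn {L : Type u} [Field L] (S : Set L) : Subfield L :=
  (algebraicClosure (Subfield.closure S) L).toSubfield

/-- A set `𝒞` of cuts of `F` is independent if for every `𝒞₀ ⊆ 𝒞` and every choice of
realizations `a C` (`C ∈ 𝒞₀`) in a real closed field `L` extending `F`, no cut in `𝒞 \ 𝒞₀` is
realized in the real closure of `F(a C : C ∈ 𝒞₀)`. -/
def IndependentCuts {F : Type u} [Field F] [LinearOrder F] (𝒞 : Set (Cut F)) : Prop :=
  ∀ 𝒞₀ ⊆ 𝒞, ∀ (L : Type u) [Field L] [LinearOrder L] [IsStrictOrderedRing L] [IsRealClosed L]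
    (f : F →+*o L) (a : 𝒞₀ → L), (∀ C : 𝒞₀, C.1.Realizes f (a C)) →
    ∀ D ∈ 𝒞 \ 𝒞₀, ∀ b ∈ realClosureIn (Set.range f ∪ Set.range a), ¬ D.Realizes f b

/-- `E` is generated over `F`, as a real closed field, by realizations `a C` (one for each
`C ∈ 𝒞`) of an independent set `𝒞` of cuts of `F`; everything takes place inside `K`. -/
def GeneratedByIndependentCuts {K : Type u} [Field K] [LinearOrder K] (F E : Subfield K) : Prop :=
  ∃ 𝒞 : Set (Cut F), IndependentCuts 𝒞 ∧
    ∃ a : 𝒞 → K, (∀ C : 𝒞, C.1.Realizes (fun x : F => (x : K)) (a C)) ∧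
      E = realClosureIn ((F : Set K) ∪ Set.range a)

/-- A tower `T i` (`i ≤ α`) as in the definition of the height: a continuous increasing sequence
of real closed subfields of `K`, from a countable one to `K`, in which each successor step is
generated by realizations of an independent set of cuts. Values `T i` for `i > α` are ignored. -/
structure IsTower (K : Type u) [Field K] [LinearOrder K] (α : Ordinal.{u})
    (T : Ordinal.{u} → Subfield K) : Prop where
  isRealClosed : ∀ i ≤ α, IsRealClosed (T i)
  mono : ∀ i j, i ≤ j → j ≤ α → T i ≤ T j
  continuous : ∀ i ≤ α, Order.IsSuccLimit i → (T i : Set K) = ⋃ j ∈ Set.Iio i, (T j : Set K)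
  countable : (T 0 : Set K).Countable
  step : ∀ i < α, GeneratedByIndependentCuts (T i) (T (Order.succ i))
  top : T α = ⊤

/-- The height `h(K)`: the least length of a tower. -/
noncomputable def height (K : Type u) [Field K] [LinearOrder K] : Ordinal.{u} :=
  sInf {α | ∃ T : Ordinal.{u} → Subfield K, IsTower K α T}

/-- `h⁺(K) = max(|h(K)|⁺, ℵ₁)`. -/
noncomputable def heightPlus (K : Type u) [Field K] [LinearOrder K] : Cardinal.{u} :=
  max (Order.succ (height K).card) ℵ₁

/-- The ordinal `o` is the length of a strictly increasing sequence in `K`. -/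
def IsIncreasingLength (K : Type u) [LinearOrder K] (o : Ordinal.{u}) : Prop :=
  ∃ s : Ordinal.{u} → K, StrictMonoOn s (Set.Iio o)

/-- The depth `d(K)`: the least regular cardinal greater than the length of every strictly
increasing sequence in `K`. -/
noncomputable def depth (K : Type u) [LinearOrder K] : Cardinal.{u} :=
  sInf {κ | κ.IsRegular ∧ ∀ o : Ordinal.{u}, IsIncreasingLength K o → o < κ.ord}

/-- The set in the definition of the depth is not empty, so the depth is one of its members. -/
theorem depth_mem (K : Type u) [LinearOrder K] :
    (depth K).IsRegular ∧ ∀ o : Ordinal.{u}, IsIncreasingLength K o → o < (depth K).ord := by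
  refine csInf_mem (s := {κ : Cardinal.{u} | κ.IsRegular ∧
    ∀ o : Ordinal.{u}, IsIncreasingLength K o → o < κ.ord})
    ⟨Order.succ (max ℵ₀ #K), isRegular_succ (le_max_left _ _), ?_⟩
  rintro o ⟨s, hs⟩
  rw [Cardinal.lt_ord, Order.lt_succ_iff]
  refine le_trans ?_ (le_max_right _ _)
  have h : Function.Injective fun x : Set.Iio o => s x :=
    fun x y hxy => Subtype.ext (hs.injOn x.2 y.2 hxy)
  have h2 := Cardinal.lift_mk_le_lift_mk_of_injective h
  rw [Cardinal.mk_Iio_ordinal, Cardinal.lift_lift] at h2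
  exact Cardinal.lift_le.1 h2

end HeightDepth

namespace HeightDepth

open Polynomial

/-! ### Real closed fields: irreducible polynomials and the intermediate value theorem -/

section RealClosed

/-! Let κ be `heightPlus K`, an uncountable regular cardinal above the cardinality of the height. It
suffices that no well-ordered subset of `K` has κ elements (`NoChain`). This is carried up a tower
of minimal length (`IsTower.noChain`): the bottom is countable, and at a limit a well-ordered set is
a union of fewer than κ sets of size below κ. The content is the successor step,
`GeneratedByIndependentCuts.noChain`.

Adjoining a single element is harmless (`noChain_realClosureIn_union_singleton`). The rational rank
of the value group grows by at most one, so a κ-chain of archimedean classes would give a κ-chain in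
the base field, and a field without κ-chains of classes in either direction has no κ-chain of
elements (`noChain_of_noChain_classes`).

For arbitrarily many realizations of independent cuts, each member of a κ-chain involves only
finitely many of them. A Δ-system style induction (`IndependentCuts.false_of_chain`) either moves a
realization that occurs κ times into a finite common part `R`, or finds two members with disjoint
supports over `R`. In the latter case independence puts an element of the real closure of F(R)
between them (`IndependentCuts.exists_between`); this cannot go on, as that field has no κ-chain.

The separation rests on the exchange property and on a transfer principle
(`exists_mem_realClosureIn_sameCut`): two elements filling the same cut generate extensions that
realize the same cuts. Its proof extends an order isomorphism between subrings to algebraic elements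
by Zorn's lemma, with the intermediate value theorem supplying roots. -/

theorem finrank_ne_two_of_forall_isSquare {F M : Type*} [Field F] [Field M] [Algebra F M]
    [CharZero F] (h : ∀ x : F, IsSquare x) : Module.finrank F M ≠ 2 := by
  intro h2
  have hfin : FiniteDimensional F M := Module.finite_of_finrank_pos (by omega)
  suffices hall : ∀ z : M, z ∈ (algebraMap F M).range by
    have : (⊥ : Subalgebra F M) = ⊤ := by
      rw [eq_top_iff]
      exact fun z _ => hall z
    have h1 := Subalgebra.bot_eq_top_iff_finrank_eq_one.1 this
    omega
  intro z
  have hz : IsIntegral F z := Algebra.IsIntegral.isIntegral z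
  have hle := minpoly.natDegree_le (A := F) z
  rw [h2] at hle
  obtain ⟨a, b, c, habc⟩ : ∃ a b c : F, minpoly F z = C a * X ^ 2 + C b * X + C c := by
    refine ⟨_, _, _, eq_quadratic_of_degree_le_two ?_⟩
    exact natDegree_le_iff_degree_le.1 hle
  have hroot : (algebraMap F M a) * z ^ 2 + algebraMap F M b * z + algebraMap F M c = 0 := by
    have := minpoly.aeval F z
    rw [habc] at this
    simpa using this
  have hinj := (algebraMap F M).injective
  by_cases ha : a = 0
  · by_cases hb : b = 0
    · have hc : c = 0 := by
        apply hinj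
        simpa [ha, hb] using hroot
      exact absurd (by simp [habc, ha, hb, hc]) (minpoly.ne_zero hz)
    · refine ⟨-c / b, ?_⟩
      have hb' : algebraMap F M b ≠ 0 := by simpa using hb
      rw [map_div₀, map_neg, div_eq_iff hb']
      rw [ha] at hroot
      simp only [map_zero, zero_mul, zero_add] at hroot
      linear_combination -hroot
  · obtain ⟨w, hw⟩ := h (b ^ 2 - 4 * a * c)
    have ha' : algebraMap F M (2 * a) ≠ 0 := by simpa using ha
    have hw' := congrArg (algebraMap F M) hw
    simp only [map_sub, map_pow, map_mul, map_ofNat] at hw'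
    have hprod : (algebraMap F M (2 * a) * z + algebraMap F M b - algebraMap F M w) *
        (algebraMap F M (2 * a) * z + algebraMap F M b + algebraMap F M w) = 0 := by
      simp only [map_mul, map_ofNat]
      linear_combination 4 * algebraMap F M a * hroot + hw'
    rcases mul_eq_zero.1 hprod with h0 | h0
    · refine ⟨(w - b) / (2 * a), ?_⟩
      rw [map_div₀, div_eq_iff ha', map_sub]
      linear_combination -h0
    · refine ⟨(-w - b) / (2 * a), ?_⟩
      rw [map_div₀, div_eq_iff ha', map_sub, map_neg]
      linear_combination -h0

theorem exists_eq_X_sub_C_mul_C {F : Type*} [Field F] {p : F[X]} (h : p.natDegree = 1) :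
    ∃ r c : F, c ≠ 0 ∧ p = (X - C r) * C c := by
  obtain ⟨r, hr⟩ := exists_root_of_degree_eq_one
    ((degree_eq_iff_natDegree_eq_of_pos one_pos).2 h)
  obtain ⟨s, hs⟩ := dvd_iff_isRoot.2 hr
  have hs0 : s ≠ 0 := by rintro rfl; simp [hs] at h
  rw [hs, natDegree_mul (X_sub_C_ne_zero r) hs0, natDegree_X_sub_C] at h
  obtain ⟨c, rfl⟩ := natDegree_eq_zero.1 (show s.natDegree = 0 by omega)
  exact ⟨r, c, by simpa using hs0, hs⟩

variable {R : Type*} [Field R] [LinearOrder R] [IsStrictOrderedRing R] [IsRealClosed R]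

/-- A square root u + vi of x + yi by the half-angle formulas: with r the modulus, u² = (r + x)/2
and v² = (r - x)/2. The sign of v is adjusted at the end. -/
theorem exists_sqrt_complex (x y : R) : ∃ u v : R, u ^ 2 - v ^ 2 = x ∧ 2 * u * v = y := by
  have sq : ∀ t : R, 0 ≤ t → ∃ r, 0 ≤ r ∧ r ^ 2 = t := fun t ht => by
    obtain ⟨r, hr⟩ := IsSquare.of_nonneg ht
    exact ⟨|r|, abs_nonneg r, by rw [sq_abs, hr, sq]⟩
  obtain ⟨r, hr0, hr⟩ := sq (x ^ 2 + y ^ 2) (by positivity)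
  have hxr : |x| ≤ r := abs_le_of_sq_le_sq (by nlinarith [sq_nonneg y]) hr0
  obtain ⟨h1, h2⟩ := abs_le.1 hxr
  obtain ⟨u, hu0, hu⟩ := sq ((r + x) / 2) (by linarith)
  obtain ⟨v, hv0, hv⟩ := sq ((r - x) / 2) (by linarith)
  have huv : (2 * u * v) ^ 2 = y ^ 2 := by
    have : (2 * u * v) ^ 2 = 4 * u ^ 2 * v ^ 2 := by ring
    rw [this, hu, hv]
    linear_combination hr
  rcases sq_eq_sq_iff_eq_or_eq_neg.1 huv with h | h
  · exact ⟨u, v, by rw [hu, hv]; ring, h⟩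
  · exact ⟨u, -v, by rw [neg_sq, hu, hv]; ring, by linear_combination -h⟩

open IntermediateField in
theorem isSquare_of_mem_adjoin_sqrt_neg_one {L : Type*} [Field L] [Algebra R L] (i : L)
    (hi : i ^ 2 = -1) (z : R⟮i⟯) : IsSquare z := by
  have hint : IsIntegral R i := ⟨X ^ 2 + 1, by monicity!, by simp [hi]⟩
  obtain ⟨x, y, hxy⟩ : ∃ x y : R, (z : L) = algebraMap R L x + algebraMap R L y * i := by
    have hz : (z : L) ∈ Algebra.adjoin R {i} := by
      rw [← adjoin_simple_toSubalgebra_of_isAlgebraic hint.isAlgebraic]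
      exact z.2
    generalize (z : L) = z' at hz
    induction hz using Algebra.adjoin_induction with
    | mem w hw => exact ⟨0, 1, by simpa using hw⟩
    | algebraMap r => exact ⟨r, 0, by simp⟩
    | add a b _ _ ha hb =>
      obtain ⟨x, y, h1⟩ := ha
      obtain ⟨x', y', h2⟩ := hb
      exact ⟨x + x', y + y', by rw [h1, h2]; simp only [map_add]; ring⟩
    | mul a b _ _ ha hb =>
      obtain ⟨x, y, h1⟩ := ha
      obtain ⟨x', y', h2⟩ := hb
      refine ⟨x * x' - y * y', x * y' + y * x', ?_⟩
      rw [h1, h2]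
      simp only [map_add, map_sub, map_mul]
      linear_combination (algebraMap R L y * algebraMap R L y') * hi
  obtain ⟨u, v, h1, h2⟩ := exists_sqrt_complex x y
  have hi' : i ∈ R⟮i⟯ := mem_adjoin_simple_self R i
  refine ⟨algebraMap R _ u + algebraMap R _ v * ⟨i, hi'⟩, ?_⟩
  apply Subtype.ext
  rw [hxy, ← h1, ← h2]
  simp only [MulMemClass.coe_mul, AddMemClass.coe_add, map_sub, map_mul, map_pow, map_ofNat]
  have e : ∀ r : R, ((algebraMap R R⟮i⟯ r : R⟮i⟯) : L) = algebraMap R L r := fun r => rfl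
  simp only [e]
  linear_combination (-(algebraMap R L v) ^ 2) * hi

open IntermediateField in
-- The fixed field of a Sylow 2-subgroup has odd degree over `R`. The minimal polynomial of a
-- primitive element then has a root in `R`, so that degree is 1 and the Galois group is a 2-group.
theorem finrank_eq_two_pow {L : Type*} [Field L] [Algebra R L] [FiniteDimensional R L]
    [IsGalois R L] : ∃ k : ℕ, Module.finrank R L = 2 ^ k := by
  obtain ⟨P⟩ : Nonempty (Sylow 2 Gal(L/R)) := inferInstance
  have hcard : Nat.card (P : Subgroup Gal(L/R)) = 2 ^ _ := P.card_eq_multiplicity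
  have h1 := finrank_fixedField_eq_card (P : Subgroup Gal(L/R))
  have h2 := Module.finrank_mul_finrank R (fixedField (P : Subgroup Gal(L/R))) L
  suffices h : Module.finrank R (fixedField (P : Subgroup Gal(L/R))) = 1 by
    rw [h, one_mul, h1, hcard] at h2
    exact ⟨_, h2.symm⟩
  have hodd : Odd (Module.finrank R (fixedField (P : Subgroup Gal(L/R)))) := by
    have hi : (P : Subgroup Gal(L/R)).index
        = Module.finrank R (fixedField (P : Subgroup Gal(L/R))) := by
      have := finrank_eq_fixingSubgroup_index L (fixedField (P : Subgroup Gal(L/R)))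
      rw [fixingSubgroup_fixedField] at this
      exact this.symm
    rw [← Nat.not_even_iff_odd, even_iff_two_dvd, ← hi]
    exact P.not_dvd_index
  obtain ⟨α, hα⟩ := Field.exists_primitive_element R (fixedField (P : Subgroup Gal(L/R)))
  have hint : IsIntegral R α := Algebra.IsIntegral.isIntegral α
  have hdeg := (Field.primitive_element_iff_minpoly_natDegree_eq R α).1 hα
  rw [← hdeg] at hodd ⊢
  obtain ⟨x, hx⟩ := IsRealClosed.exists_isRoot_of_odd_natDegree hodd
  exact natDegree_eq_of_degree_eq_some (degree_eq_one_of_irreducible_of_root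
    (minpoly.irreducible hint) hx)

/-- Irreducible polynomials over a real closed field are linear or quadratic. -/
theorem natDegree_le_two_of_irreducible {p : R[X]} (hp : Irreducible p) : p.natDegree ≤ 2 := by
  let L := (p * (X ^ 2 + 1)).SplittingField
  have hq : (X ^ 2 + 1 : R[X]) ≠ 0 := (by monicity! : (X ^ 2 + 1 : R[X]).Monic).ne_zero
  have hq2 : (X ^ 2 + 1 : R[X]).natDegree = 2 := by compute_degree!
  have hsplit : ((p * (X ^ 2 + 1)).map (algebraMap R L)).Splits :=
    SplittingField.splits _
  have hne : (p * (X ^ 2 + 1)).map (algebraMap R L) ≠ 0 :=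
    (Polynomial.map_ne_zero (mul_ne_zero hp.ne_zero hq))
  have hgal : IsGalois R L := { }
  obtain ⟨i, hi⟩ : ∃ i : L, i ^ 2 = -1 := by
    have : ((X ^ 2 + 1 : R[X]).map (algebraMap R L)).Splits :=
      hsplit.of_dvd hne (Polynomial.map_dvd _ (dvd_mul_left _ _))
    obtain ⟨i, hi⟩ := this.exists_eval_eq_zero (by
      rw [degree_map, degree_eq_natDegree hq, hq2]; norm_num)
    refine ⟨i, ?_⟩
    simp only [Polynomial.map_add, Polynomial.map_pow, map_X, Polynomial.map_one, eval_add,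
      eval_pow, eval_X, eval_one] at hi
    linear_combination hi
  obtain ⟨x, hx⟩ : ∃ x : L, aeval x p = 0 := by
    have : (p.map (algebraMap R L)).Splits :=
      hsplit.of_dvd hne (Polynomial.map_dvd _ (dvd_mul_right _ _))
    obtain ⟨x, hx⟩ := this.exists_eval_eq_zero (by
      rw [degree_map]
      exact (degree_pos_of_irreducible hp).ne')
    exact ⟨x, by rwa [eval_map_algebraMap] at hx⟩
  have hfin : FiniteDimensional R L := inferInstance
  have hint : IsIntegral R i := Algebra.IsIntegral.isIntegral i
  have hF : Module.finrank R (IntermediateField.adjoin R {i}) ≤ 2 := by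
    rw [IntermediateField.adjoin.finrank hint]
    have hd : minpoly R i ∣ X ^ 2 + 1 := minpoly.dvd R i (by simp [hi])
    exact (natDegree_le_of_dvd hd hq).trans hq2.le
  have hL : Module.finrank (IntermediateField.adjoin R {i}) L = 1 := by
    obtain ⟨k, hk⟩ := finrank_eq_two_pow (R := R) (L := L)
    have hm := Module.finrank_mul_finrank R (IntermediateField.adjoin R {i}) L
    obtain ⟨m, -, hm2⟩ := (Nat.dvd_prime_pow Nat.prime_two).1
      ((Dvd.intro_left _ hm).trans (dvd_of_eq hk))
    rcases m with _ | m
    · simpa using hm2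
    exfalso
    -- A nontrivial 2-group has a subgroup of index 2. Its fixed field would be quadratic over R(i),
    -- where every element is already a square.
    have hc := IsGalois.card_aut_eq_finrank (IntermediateField.adjoin R {i}) L
    obtain ⟨H, hH⟩ := Sylow.exists_subgroup_card_pow_prime
      (G := Gal(L/(IntermediateField.adjoin R {i}))) 2 (n := m)
      (by rw [hc, hm2]; exact pow_dvd_pow _ (Nat.le_succ m))
    have h1 := IntermediateField.finrank_fixedField_eq_card H
    have h2 := Module.finrank_mul_finrank (IntermediateField.adjoin R {i})
      (IntermediateField.fixedField H) L
    rw [h1, hH, hm2, Nat.pow_succ'] at h2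
    exact finrank_ne_two_of_forall_isSquare (isSquare_of_mem_adjoin_sqrt_neg_one i hi)
      (Nat.eq_of_mul_eq_mul_right (by positivity) h2)
  have hLR : Module.finrank R L ≤ 2 := by
    rw [← Module.finrank_mul_finrank R (IntermediateField.adjoin R {i}) L, hL, mul_one]
    exact hF
  have hx' : IsIntegral R x := Algebra.IsIntegral.isIntegral x
  have hd := Associated.symm (minpoly.eq_of_irreducible hp hx ▸
    (associated_mul_unit_right p (C p.leadingCoeff⁻¹)
      (by simp [hp.ne_zero])))
  rw [← natDegree_eq_of_degree_eq (degree_eq_degree_of_associated hd)]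
  exact (minpoly.natDegree_le x).trans hLR

/-- An irreducible polynomial of degree at least two over a real closed field takes values of only
one sign in any ordered extension. -/
theorem eval₂_mul_eval₂_pos_of_irreducible {L : Type*} [Field L] [LinearOrder L]
    [IsStrictOrderedRing L] (f : R →+* L) {p : R[X]} (hp : Irreducible p)
    (h1 : p.natDegree ≠ 1) (x y : L) : 0 < p.eval₂ f x * p.eval₂ f y := by
  have hfm : ∀ a : R, 0 < a → 0 < f a := fun a ha => by
    obtain ⟨r, hr⟩ := IsSquare.of_nonneg ha.le
    have : f r ≠ 0 := (map_ne_zero f).2 (by rintro rfl; simp [hr] at ha)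
    rw [hr, map_mul]
    exact mul_self_pos.2 this
  have h2 := natDegree_le_two_of_irreducible hp
  obtain ⟨a, b, c, habc⟩ : ∃ a b c : R, p = C a * X ^ 2 + C b * X + C c :=
    ⟨_, _, _, eq_quadratic_of_degree_le_two (natDegree_le_iff_degree_le.1 h2)⟩
  have hd0 : p.natDegree ≠ 0 := hp.natDegree_pos.ne'
  have ha : a ≠ 0 := by
    rintro rfl
    have : p.natDegree ≤ 1 := by
      rw [habc]; simp only [C_0, zero_mul, zero_add]; exact natDegree_linear_le
    omega
  have hnoroot : ∀ r, ¬ p.IsRoot r := fun r hr => h1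
    (natDegree_eq_of_degree_eq_some (degree_eq_one_of_irreducible_of_root hp hr))
  have hdisc : 0 < 4 * a * c - b ^ 2 := by
    by_contra hneg
    obtain ⟨w, hw⟩ := IsSquare.of_nonneg (x := b ^ 2 - 4 * a * c) (by linarith)
    refine hnoroot ((w - b) / (2 * a)) ?_
    rw [habc]
    simp only [IsRoot.def, eval_add, eval_mul, eval_C, eval_pow, eval_X]
    field_simp
    linear_combination -hw
  -- Completing the square: 4a·p(t) is a square plus the negated discriminant, which is positive
  -- because `p` has no root.
  have key : ∀ t : L, 0 < f a * p.eval₂ f t := fun t => by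
    have hd := hfm _ hdisc
    have h4 : 4 * (f a * p.eval₂ f t) = (2 * f a * t + f b) ^ 2 + f (4 * a * c - b ^ 2) := by
      rw [habc]
      simp only [eval₂_add, eval₂_mul, eval₂_C, eval₂_pow, eval₂_X, map_sub, map_mul, map_ofNat,
        map_pow]
      ring
    nlinarith [sq_nonneg (2 * f a * t + f b)]
  have h3 := mul_pos (key x) (key y)
  have h5 : 0 < f a * f a := mul_self_pos.2 ((map_ne_zero f).2 ha)
  have h6 : 0 < (f a * f a) * (p.eval₂ f x * p.eval₂ f y) := by
    calc 0 < _ := h3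
      _ = _ := by ring
  exact (pos_iff_pos_of_mul_pos h6).1 h5

/-- A real closed field has no proper algebraic ordered extension. -/
theorem mem_range_of_eval₂_eq_zero {L : Type*} [Field L] [LinearOrder L]
    [IsStrictOrderedRing L] (f : R →+* L) {p : R[X]} (hp : p ≠ 0) {x : L}
    (hx : p.eval₂ f x = 0) : x ∈ Set.range f := by
  induction p using WfDvdMonoid.induction_on_irreducible with
  | zero => exact absurd rfl hp
  | unit u hu =>
    obtain ⟨c, hc, rfl⟩ := Polynomial.isUnit_iff.1 hu
    rw [eval₂_C] at hx
    exact absurd hx ((map_ne_zero f).2 hc.ne_zero)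
  | mul q p hq0 hpirr ih =>
    rw [eval₂_mul] at hx
    rcases mul_eq_zero.1 hx with h | h
    · by_cases h1 : p.natDegree = 1
      · obtain ⟨r, c, hc, hs⟩ := exists_eq_X_sub_C_mul_C h1
        rw [hs, eval₂_mul, eval₂_C] at h
        have := (mul_eq_zero.1 h).resolve_right ((map_ne_zero f).2 hc)
        simp only [eval₂_sub, eval₂_X, eval₂_C] at this
        exact ⟨r, by linear_combination -this⟩
      · have := eval₂_mul_eval₂_pos_of_irreducible f hpirr h1 x x
        simp [h] at this
    · exact ih hq0 h

/-- The intermediate value theorem for polynomials over a real closed field. -/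
theorem exists_root_of_eval_mul_eval_neg {p : R[X]} {x y : R} (hxy : x < y)
    (h : p.eval x * p.eval y < 0) : ∃ z, x < z ∧ z < y ∧ p.eval z = 0 := by
  by_contra! hno
  suffices 0 ≤ p.eval x * p.eval y by linarith
  clear h
  induction p using WfDvdMonoid.induction_on_irreducible with
  | zero => simp
  | unit u hu =>
    obtain ⟨c, hc, rfl⟩ := Polynomial.isUnit_iff.1 hu
    simpa using mul_self_nonneg c
  | mul q p hq0 hpirr ih =>
    have ih' := ih fun z h1 h2 h3 => hno z h1 h2 (by simp [h3])
    suffices 0 ≤ p.eval x * p.eval y by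
      have := mul_nonneg this ih'
      simp only [eval_mul]
      linarith
    by_cases h1 : p.natDegree = 1
    · obtain ⟨r, c, -, hs⟩ := exists_eq_X_sub_C_mul_C h1
      have hr' : ¬ (x < r ∧ r < y) := fun h => hno r h.1 h.2 (by simp [hs])
      have hxr : 0 ≤ (x - r) * (y - r) := by
        rcases le_or_gt r x with h | h
        · exact mul_nonneg (by linarith) (by linarith)
        · have : y ≤ r := not_lt.1 fun h' => hr' ⟨h, h'⟩
          exact mul_nonneg_of_nonpos_of_nonpos (by linarith) (by linarith)
      rw [hs]
      simp only [eval_mul, eval_sub, eval_X, eval_C]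
      nlinarith [mul_nonneg hxr (mul_self_nonneg c)]
    · exact (eval₂_mul_eval₂_pos_of_irreducible (RingHom.id R) hpirr h1 x y).le

end RealClosed

/-! ### The relative real closure as a closure operator -/

section Closure

/-- With polynomials over `K` whose coefficients are constrained, the base field can vary without
changing types. -/
theorem isAlgebraic_iff_exists_coeff_mem_range {k K : Type*} [Field k] [Field K] [Algebra k K]
    {x : K} : IsAlgebraic k x ↔
      ∃ p : K[X], p ≠ 0 ∧ (∀ n, p.coeff n ∈ Set.range (algebraMap k K)) ∧ p.eval x = 0 := by
  constructor
  · rintro ⟨p, hp, hx⟩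
    exact ⟨p.map (algebraMap k K), Polynomial.map_ne_zero hp, fun n => ⟨p.coeff n, by simp⟩,
      by rwa [eval_map_algebraMap]⟩
  · rintro ⟨p, hp, hc, hx⟩
    obtain ⟨q, rfl⟩ := (mem_lifts _).1 ((lifts_iff_coeff_lifts p).2 hc)
    exact ⟨q, by rintro rfl; simp at hp, by rwa [eval_map_algebraMap] at hx⟩

variable {K : Type*} [Field K] {S T : Set K} {x a b : K}

theorem mem_realClosureIn_iff_isAlgebraic :
    x ∈ realClosureIn S ↔ IsAlgebraic (Subfield.closure S) x :=
  mem_algebraicClosure_iff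

theorem range_algebraMap_subfield (k : Subfield K) : Set.range (algebraMap k K) = k :=
  Subtype.range_coe

theorem mem_realClosureIn_iff : x ∈ realClosureIn S ↔
    ∃ p : K[X], p ≠ 0 ∧ (∀ n, p.coeff n ∈ Subfield.closure S) ∧ p.eval x = 0 := by
  rw [mem_realClosureIn_iff_isAlgebraic, isAlgebraic_iff_exists_coeff_mem_range,
    range_algebraMap_subfield]
  rfl

theorem closure_le_realClosureIn : Subfield.closure S ≤ realClosureIn S := fun x hx =>
  mem_realClosureIn_iff_isAlgebraic.2 (isAlgebraic_algebraMap (⟨x, hx⟩ : Subfield.closure S))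

theorem subset_realClosureIn : S ⊆ realClosureIn S := fun _ hx =>
  closure_le_realClosureIn (Subfield.subset_closure hx)

theorem mem_realClosureIn_of_coeff_mem {p : K[X]} (hp : p ≠ 0)
    (hc : ∀ n, p.coeff n ∈ realClosureIn S) (hx : p.eval x = 0) : x ∈ realClosureIn S := by
  rw [mem_realClosureIn_iff_isAlgebraic]
  have : IsAlgebraic (algebraicClosure (Subfield.closure S) K) x :=
    isAlgebraic_iff_exists_coeff_mem_range.2 ⟨p, hp, fun n => ⟨⟨_, hc n⟩, rfl⟩, hx⟩
  exact IsAlgebraic.restrictScalars _ this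

theorem realClosureIn_le (h : S ⊆ realClosureIn T) : realClosureIn S ≤ realClosureIn T := by
  intro x hx
  obtain ⟨p, hp, hc, hx⟩ := mem_realClosureIn_iff.1 hx
  exact mem_realClosureIn_of_coeff_mem hp (fun n => Subfield.closure_le.2 h (hc n)) hx

theorem realClosureIn_mono (h : S ⊆ T) : realClosureIn S ≤ realClosureIn T :=
  realClosureIn_le (h.trans subset_realClosureIn)

theorem realClosureIn_union_left :
    realClosureIn ((realClosureIn S : Set K) ∪ T) = realClosureIn (S ∪ T) := by
  apply le_antisymm
  · refine realClosureIn_le (Set.union_subset ?_ ?_)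
    · exact realClosureIn_mono Set.subset_union_left
    · exact Set.subset_union_right.trans subset_realClosureIn
  · exact realClosureIn_mono (Set.union_subset_union_left _ subset_realClosureIn)

theorem closure_subfield_union (S T : Set K) :
    Subfield.closure ((Subfield.closure S : Set K) ∪ T) = Subfield.closure (S ∪ T) := by
  rw [Subfield.closure_union, Subfield.closure_eq, Subfield.closure_union]

theorem mem_adjoin_closure_iff :
    x ∈ IntermediateField.adjoin (Subfield.closure S) T ↔ x ∈ Subfield.closure (S ∪ T) := by
  rw [← closure_subfield_union, ← IntermediateField.mem_toSubfield,
    IntermediateField.adjoin_toSubfield, range_algebraMap_subfield]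

open scoped IntermediateField.algebraAdjoinAdjoin in
theorem isAlgebraic_adjoin_iff_mem_realClosureIn :
    IsAlgebraic (Algebra.adjoin (Subfield.closure S) T) x ↔ x ∈ realClosureIn (S ∪ T) := by
  rw [IsFractionRing.isAlgebraic_iff _ (IntermediateField.adjoin (Subfield.closure S) T) K,
    isAlgebraic_iff_exists_coeff_mem_range, mem_realClosureIn_iff]
  have : Set.range (algebraMap (IntermediateField.adjoin (Subfield.closure S) T) K)
      = (Subfield.closure (S ∪ T) : Set K) := by
    ext y
    rw [SetLike.mem_coe, ← mem_adjoin_closure_iff]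
    exact Set.ext_iff.1 Subtype.range_coe y
  rw [this]
  rfl

/-- The exchange property of algebraic dependence. -/
theorem realClosureIn_exchange (hb : b ∈ realClosureIn (S ∪ {a})) (hbS : b ∉ realClosureIn S) :
    a ∈ realClosureIn (S ∪ {b}) := by
  by_contra ha
  have hab : a ≠ b := by
    rintro rfl
    exact ha (subset_realClosureIn (by simp))
  have hbase : ∀ c, c ∉ realClosureIn S → AlgebraicIndepOn (Subfield.closure S) id {c} := by
    intro c hc
    rw [← insert_empty_eq, AlgebraicIndepOn.insert_iff (by simp)]
    refine ⟨?_, ?_⟩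
    · rw [AlgebraicIndepOn, algebraicIndependent_empty_type_iff]
      exact (algebraMap (Subfield.closure S) K).injective
    · rw [Set.image_empty]
      rw [Transcendental, id, isAlgebraic_adjoin_iff_mem_realClosureIn, Set.union_empty]
      exact hc
  -- If the exchange fails, the pair a, b is algebraically independent over `S`. Reading the pair in
  -- the other order contradicts `hb`.
  have h1 : AlgebraicIndepOn (Subfield.closure S) id (insert a {b}) := by
    rw [AlgebraicIndepOn.insert_iff (by simpa using hab)]
    refine ⟨hbase b hbS, ?_⟩
    rwa [Transcendental, Set.image_id, id, isAlgebraic_adjoin_iff_mem_realClosureIn]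
  rw [Set.pair_comm, AlgebraicIndepOn.insert_iff (by simpa using hab.symm)] at h1
  refine h1.2 ?_
  rwa [Set.image_id, id, isAlgebraic_adjoin_iff_mem_realClosureIn]

theorem exists_finset_of_mem_realClosureIn (hx : x ∈ realClosureIn (S ∪ T)) :
    ∃ t : Finset K, (t : Set K) ⊆ T ∧ x ∈ realClosureIn (S ∪ t) := by
  classical
  obtain ⟨p, hp, hc, hx⟩ := mem_realClosureIn_iff.1 hx
  have : ∀ n, ∃ t : Finset K, (t : Set K) ⊆ T ∧ p.coeff n ∈ Subfield.closure (S ∪ t) := by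
    intro n
    have := hc n
    rw [← mem_adjoin_closure_iff] at this
    obtain ⟨t, ht, h⟩ := IntermediateField.exists_finset_of_mem_adjoin this
    exact ⟨t, ht, mem_adjoin_closure_iff.1 h⟩
  choose t ht htp using this
  refine ⟨p.support.biUnion t, by simpa using fun n _ => ht n,
    mem_realClosureIn_iff.2 ⟨p, hp, fun n => ?_, hx⟩⟩
  by_cases hn : n ∈ p.support
  · refine Subfield.closure_mono (Set.union_subset_union_right _ ?_) (htp n)
    exact_mod_cast Finset.subset_biUnion_of_mem t hn
  · rw [notMem_support_iff.1 hn]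
    exact zero_mem _

/-- A relatively algebraically closed subfield of a real closed field is real closed. -/
theorem isRealClosed_realClosureIn [LinearOrder K] [IsStrictOrderedRing K] [IsRealClosed K]
    (S : Set K) : IsRealClosed (realClosureIn S) := by
  refine IsRealClosed.of_linearOrderedField ?_ ?_
  · rintro ⟨x, hx⟩ h0
    obtain ⟨r, hr⟩ := IsSquare.of_nonneg (show (0 : K) ≤ x from h0)
    have hrS : r ∈ realClosureIn S := by
      refine mem_realClosureIn_of_coeff_mem (p := X ^ 2 - C x)
        (X_pow_sub_C_ne_zero two_pos x) (fun n => ?_) (by simp [hr, sq])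
      rw [coeff_sub, coeff_X_pow, coeff_C]
      refine sub_mem ?_ ?_
      · split_ifs
        exacts [one_mem _, zero_mem _]
      · split_ifs
        exacts [hx, zero_mem _]
    exact ⟨⟨r, hrS⟩, Subtype.ext hr⟩
  · intro f hf
    obtain ⟨x, hx⟩ := IsRealClosed.exists_isRoot_of_odd_natDegree
      (f := f.map (realClosureIn S).subtype) (by rwa [natDegree_map])
    have hxS : x ∈ realClosureIn S :=
      mem_realClosureIn_of_coeff_mem
        (Polynomial.map_ne_zero (by rintro rfl; simp at hf)) (fun n => by simp) hx
    refine ⟨⟨x, hxS⟩, (realClosureIn S).subtype.injective ?_⟩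
    rw [IsRoot.def, eval_map] at hx
    have := eval₂_at_apply (p := f) (realClosureIn S).subtype ⟨x, hxS⟩
    rw [← this, map_zero]
    exact hx

end Closure

/-! ### Archimedean classes in algebraic extensions -/

section Classes

open ArchimedeanClass

variable {K : Type*} [Field K] [LinearOrder K] [IsStrictOrderedRing K]

theorem mk_mul_congr {x y : K} (h : mk x = mk y) (z : K) : mk (x * z) = mk (y * z) := by
  rw [mk_mul, mk_mul, h]

/-- Either two monomials of `p` have the same archimedean class at `y`, or the value of `p` at `y`
has the archimedean class of one of them. -/
theorem exists_mk_eq_of_eval (p : K[X]) (hp : p ≠ 0) {y : K} (hy : y ≠ 0) :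
    (∃ i ∈ p.support, ∃ j ∈ p.support, i < j ∧
      mk (p.coeff i * y ^ i) = mk (p.coeff j * y ^ j)) ∨
    (p.eval y ≠ 0 ∧ ∃ i ∈ p.support, mk (p.eval y) = mk (p.coeff i * y ^ i)) := by
  by_cases h : ∃ i ∈ p.support, ∃ j ∈ p.support, i < j ∧
      mk (p.coeff i * y ^ i) = mk (p.coeff j * y ^ j)
  · exact Or.inl h
  right
  push Not at h
  -- The least class belongs to the largest monomial. Since no two classes coincide, this monomial
  -- dominates the sum of all the others.
  obtain ⟨i, hi, hmin⟩ := p.support.exists_min_image (fun i => mk (p.coeff i * y ^ i))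
    (nonempty_support_iff.2 hp)
  have hi0 : p.coeff i * y ^ i ≠ 0 := mul_ne_zero (mem_support_iff.1 hi) (pow_ne_zero _ hy)
  have hrest : mk (p.coeff i * y ^ i) <
      mk (∑ j ∈ p.support.erase i, p.coeff j * y ^ j) := by
    have := (addValuation (R := K)).map_lt_sum (s := p.support.erase i)
      (f := fun j => p.coeff j * y ^ j) (g := mk (p.coeff i * y ^ i))
      (by rwa [Ne, mk_eq_top_iff]) ?_
    · simpa using this
    intro j hj
    obtain ⟨hji, hj⟩ := Finset.mem_erase.1 hj
    rw [addValuation_apply]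
    refine lt_of_le_of_ne (hmin j hj) fun heq => ?_
    rcases lt_or_gt_of_ne hji with hlt | hlt
    · exact h j hj i hi hlt heq.symm
    · exact h i hi j hj hlt heq
  have hsum : p.eval y = p.coeff i * y ^ i + ∑ j ∈ p.support.erase i, p.coeff j * y ^ j := by
    rw [eval_eq_sum, Polynomial.sum,
      Finset.add_sum_erase p.support (fun j => p.coeff j * y ^ j) hi]
  have hmk : mk (p.eval y) = mk (p.coeff i * y ^ i) := by
    rw [hsum]
    exact mk_add_eq_mk_left hrest
  refine ⟨fun h0 => hi0 ?_, i, hi, hmk⟩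
  rwa [h0, eq_comm, mk_zero, mk_eq_top_iff] at hmk

/-- A coincidence of archimedean classes of two monomials. -/
theorem mk_pow_eq_of_mk_monomial_eq {a b y : K} (hb : b ≠ 0) (hy : y ≠ 0) {i j : ℕ}
    (hij : i < j) (h : mk (a * y ^ i) = mk (b * y ^ j)) : mk (y ^ (j - i)) = mk (a / b) := by
  have h2 := mk_mul_congr h (b * y ^ i)⁻¹
  have e1 : a * y ^ i * (b * y ^ i)⁻¹ = a / b := by field_simp
  have e2 : b * y ^ j * (b * y ^ i)⁻¹ = y ^ (j - i) := by
    rw [← Nat.sub_add_cancel hij.le, pow_add, Nat.add_sub_cancel]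
    field_simp
  rw [e1, e2] at h2
  exact h2.symm

variable {S : Set K} {F : Subfield K} {a x y : K}

/-- At a root of a polynomial no single monomial can dominate, so two monomials have the same class.
Hence an algebraic extension only passes to the divisible hull of the value group. -/
theorem exists_mk_pow_eq_of_mem_realClosureIn (hy : y ∈ realClosureIn S) (hy0 : y ≠ 0) :
    ∃ n : ℕ, 0 < n ∧ ∃ c ∈ Subfield.closure S, c ≠ 0 ∧ mk (y ^ n) = mk c := by
  obtain ⟨p, hp, hc, hpy⟩ := mem_realClosureIn_iff.1 hy
  rcases exists_mk_eq_of_eval p hp hy0 with ⟨i, hi, j, hj, hij, h⟩ | ⟨h, -⟩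
  · exact ⟨j - i, by omega, p.coeff i / p.coeff j, div_mem (hc i) (hc j),
      div_ne_zero (mem_support_iff.1 hi) (mem_support_iff.1 hj),
      mk_pow_eq_of_mk_monomial_eq (mem_support_iff.1 hj) hy0 hij h⟩
  · exact absurd hpy h

/-- When no positive multiple of the class of `x` is a class of `F`, the monomials of a polynomial
over `F` have distinct classes at `x`, so its value has the class of one of them. Elements of F(x)
are quotients of such values. -/
theorem exists_mk_eq_zpow_mul_of_mem_closure (hx : x ≠ 0)
    (hxF : ∀ n : ℕ, 0 < n → ∀ c ∈ F, c ≠ 0 → mk (x ^ n) ≠ mk c)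
    (hy : y ∈ Subfield.closure ((F : Set K) ∪ {x})) (hy0 : y ≠ 0) :
    ∃ m : ℤ, ∃ c ∈ F, c ≠ 0 ∧ mk y = mk (x ^ m * c) := by
  have key : ∀ p : F[X], aeval x p ≠ 0 → ∃ m : ℤ, ∃ c ∈ F, c ≠ 0 ∧ mk (aeval x p) =
      mk (x ^ m * c) := by
    intro p hp
    have hp0 : p.map (algebraMap F K) ≠ 0 := by
      rw [Polynomial.map_ne_zero_iff (algebraMap F K).injective]
      rintro rfl
      simp at hp
    have hco : ∀ i, (p.map (algebraMap F K)).coeff i ∈ F := fun i => by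
      rw [coeff_map]
      exact (p.coeff i).2
    rw [← eval_map_algebraMap]
    rcases exists_mk_eq_of_eval _ hp0 hx with ⟨i, hi, j, hj, hij, h⟩ | ⟨-, i, hi, h⟩
    · exact absurd (mk_pow_eq_of_mk_monomial_eq (mem_support_iff.1 hj) hx hij h)
        (hxF _ (by omega) _ (div_mem (hco i) (hco j))
          (div_ne_zero (mem_support_iff.1 hi) (mem_support_iff.1 hj)))
    · exact ⟨i, _, hco i, mem_support_iff.1 hi, by rw [h, zpow_natCast, mul_comm]⟩
  have hmem : y ∈ IntermediateField.adjoin F {x} := by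
    rw [← IntermediateField.mem_toSubfield, IntermediateField.adjoin_toSubfield,
      range_algebraMap_subfield]
    exact hy
  obtain ⟨r, s, rfl⟩ := (IntermediateField.mem_adjoin_simple_iff F y).1 hmem
  obtain ⟨hr, hs⟩ := div_ne_zero_iff.1 hy0
  obtain ⟨m, c, hc, hc0, h1⟩ := key r hr
  obtain ⟨m', c', hc', hc0', h2⟩ := key s hs
  refine ⟨m - m', c / c', div_mem hc hc', div_ne_zero hc0 hc0', ?_⟩
  rw [div_eq_mul_inv, mk_mul_congr h1, mul_comm, mk_mul, ArchimedeanClass.mk_inv, h2,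
    ← ArchimedeanClass.mk_inv, ← mk_mul,
    zpow_sub₀ hx]
  congr 1
  field_simp

/-- Adjoining one element enlarges the rational rank of the value group by at most one. -/
theorem exists_forall_mk_pow_eq (F : Subfield K) (a : K) : ∃ x : K, x ≠ 0 ∧
    ∀ y ∈ realClosureIn ((F : Set K) ∪ {a}), y ≠ 0 →
      ∃ n : ℕ, 0 < n ∧ ∃ m : ℤ, ∃ c ∈ F, c ≠ 0 ∧ mk (y ^ n) = mk (x ^ m * c) := by
  -- If the extension contains an `x` of new rational class, exchange lets `x` replace `a` as
  -- generator. Otherwise every class is already torsion over those of `F`, and x = 1 serves.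
  by_cases H : ∃ x ∈ realClosureIn ((F : Set K) ∪ {a}), x ≠ 0 ∧
      ∀ n : ℕ, 0 < n → ∀ c ∈ F, c ≠ 0 → mk (x ^ n) ≠ mk c
  · obtain ⟨x, hx, hx0, hxF⟩ := H
    refine ⟨x, hx0, fun y hy hy0 => ?_⟩
    have hxF' : x ∉ realClosureIn (F : Set K) := fun h => by
      obtain ⟨n, hn, c, hc, hc0, h⟩ := exists_mk_pow_eq_of_mem_realClosureIn h hx0
      rw [Subfield.closure_eq] at hc
      exact hxF n hn c hc hc0 h
    have ha := realClosureIn_exchange hx hxF'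
    have hy' : y ∈ realClosureIn ((F : Set K) ∪ {x}) := by
      refine realClosureIn_le (Set.union_subset ?_ ?_) hy
      · exact Set.subset_union_left.trans subset_realClosureIn
      · simpa using ha
    obtain ⟨n, hn, d, hd, hd0, h⟩ := exists_mk_pow_eq_of_mem_realClosureIn hy' hy0
    obtain ⟨m, c, hc, hc0, h'⟩ := exists_mk_eq_zpow_mul_of_mem_closure hx0 hxF hd hd0
    exact ⟨n, hn, m, c, hc, hc0, h.trans h'⟩
  · push Not at H
    refine ⟨1, one_ne_zero, fun y hy hy0 => ?_⟩
    obtain ⟨n, hn, c, hc, hc0, h⟩ := H y hy hy0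
    exact ⟨n, hn, 0, c, hc, hc0, by simpa using h⟩

end Classes

/-! ### Long chains -/

section Chains

/-- Every well-ordered subset of `S` has fewer than `κ` elements. -/
def NoChain (κ : Cardinal.{u}) {α : Type u} [LinearOrder α] (S : Set α) : Prop :=
  ∀ W ⊆ S, W.IsWF → #W < κ

variable {κ : Cardinal.{u}} {α : Type u} [LinearOrder α] {S T : Set α}

theorem NoChain.mono (h : NoChain κ T) (hST : S ⊆ T) : NoChain κ S :=
  fun W hW => h W (hW.trans hST)

theorem exists_strictMono_of_not_noChain (h : ¬ NoChain κ S) :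
    ∃ g : κ.ord.ToType → α, StrictMono g ∧ ∀ i, g i ∈ S := by
  unfold NoChain at h
  push Not at h
  obtain ⟨W, hWS, hW, hκ⟩ := h
  have : WellFoundedLT W := ⟨hW⟩
  have hle : Ordinal.type (α := κ.ord.ToType) (· < ·) ≤ Ordinal.type (α := W) (· < ·) := by
    rw [Ordinal.type_toType, Cardinal.ord_le, Ordinal.card_type]
    exact hκ
  obtain ⟨e⟩ := Ordinal.type_le_iff'.1 hle
  exact ⟨fun i => e i, fun i j hij => e.map_rel_iff.2 hij, fun i => hWS (e i).2⟩

theorem NoChain.mk_lt_of_strictMonoOn {ι : Type u} [LinearOrder ι] [WellFoundedLT ι]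
    (h : NoChain κ S) {J : Set ι} {g : ι → α} (hg : StrictMonoOn g J) (hgS : ∀ i ∈ J, g i ∈ S) :
    #J < κ := by
  have hinj := hg.injOn
  rw [← mk_image_eq_of_injOn _ _ hinj]
  refine h _ (Set.image_subset_iff.2 hgS) ?_
  rw [Set.isWF_iff_no_descending_seq]
  intro f hf hfm
  choose w hw hwf using hfm
  refine (RelEmbedding.natGT w ?_).not_wellFounded (wellFounded_lt (α := ι))
  intro n
  have : f (n + 1) < f n := hf (Nat.lt_succ_self n)
  rw [← hwf, ← hwf] at this
  exact (hg.lt_iff_lt (hw _) (hw _)).1 this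

theorem exists_forall_lt_of_mk_lt (hκ : κ.IsRegular) {J : Set κ.ord.ToType} (hJ : #J < κ) :
    ∃ i, ∀ j ∈ J, j < i := by
  by_contra! hno
  have huniv : (⋃ j : J, Set.Iic (j : κ.ord.ToType)) = Set.univ := by
    refine Set.eq_univ_of_forall fun i => ?_
    obtain ⟨j, hj, hij⟩ := hno i
    exact Set.mem_iUnion.2 ⟨⟨j, hj⟩, hij⟩
  have hlt : #(⋃ j : J, Set.Iic (j : κ.ord.ToType)) < κ := by
    rw [card_iUnion_lt_iff_forall_of_isRegular hκ hJ]
    intro j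
    rw [← Set.Iio_insert]
    exact (mk_insert_le).trans_lt
      (add_lt_of_lt hκ.aleph0_le (by simpa using mk_Iio_lt j.1 (by simp))
        (one_lt_aleph0.trans_le hκ.aleph0_le))
  rw [huniv, mk_univ, mk_ord_toType] at hlt
  exact lt_irrefl _ hlt

theorem exists_gt_toType (hκ : κ.IsRegular) (i j : κ.ord.ToType) : ∃ k, i < k ∧ j < k := by
  obtain ⟨k, hk⟩ := exists_forall_lt_of_mk_lt hκ (J := {i, j})
    ((Set.toFinite _).lt_aleph0.trans_le hκ.aleph0_le)
  exact ⟨k, hk i (by simp), hk j (by simp)⟩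

/-- A monotone function from a long well-order is eventually constant. -/
theorem NoChain.eventually_const (hκ : κ.IsRegular) (h : NoChain κ S) {f : κ.ord.ToType → α}
    (i₀ : κ.ord.ToType) (hf : MonotoneOn f (Set.Ici i₀)) (hfS : ∀ i ≥ i₀, f i ∈ S) :
    ∃ i₁ ≥ i₀, ∀ i ≥ i₁, f i = f i₁ := by
  -- `J` collects the indices where `f` takes a new value. It is small because `f` is strictly
  -- increasing on it, and beyond a bound for `J` nothing new appears.
  set J : Set κ.ord.ToType := {i | i₀ ≤ i ∧ ∀ j, i₀ ≤ j → j < i → f j < f i} with hJdef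
  have hJ : #J < κ := h.mk_lt_of_strictMonoOn (g := f)
    (fun i hi j hj hij => hj.2 i hi.1 hij) (fun i hi => hfS i hi.1)
  obtain ⟨i₁, hi₁⟩ := exists_forall_lt_of_mk_lt hκ hJ
  refine ⟨max i₀ i₁, le_max_left _ _, fun i => ?_⟩
  induction i using WellFoundedLT.induction with
  | ind i ih =>
    intro hi
    by_contra hne
    have h0 : i₀ ≤ i := (le_max_left _ _).trans hi
    have hlt : f (max i₀ i₁) < f i :=
      lt_of_le_of_ne (hf (Set.mem_Ici.2 (le_max_left _ _)) h0 hi) (Ne.symm hne)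
    refine absurd (hi₁ i ⟨h0, fun j hj hji => ?_⟩) (not_lt.2 ((le_max_right _ _).trans hi))
    rcases le_total (max i₀ i₁) j with hj' | hj'
    · rwa [ih j hji hj']
    · exact (hf hj (Set.mem_Ici.2 (le_max_left _ _)) hj').trans_lt hlt

/-- If `S` has no long chain, then the members of a long chain eventually are not separated by
elements of `S`. -/
theorem NoChain.eventually_disjoint (hκ : κ.IsRegular) (h : NoChain κ S) {g : κ.ord.ToType → α}
    (hg : StrictMono g) : ∃ i₀, ∀ i ≥ i₀, ∀ s ∈ S, ¬ (g i₀ ≤ s ∧ s ≤ g i) := by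
  -- `J` collects the indices `i` such that some element of `S` lies below `g i` and above all
  -- earlier members. Such elements form a chain in `S` indexed by `J`, so `J` is bounded.
  set J : Set κ.ord.ToType := {i | ∃ s ∈ S, s < g i ∧ ∀ j < i, g j ≤ s} with hJdef
  have hJ' : ∀ i ∈ J, ∃ s ∈ S, s < g i ∧ ∀ j < i, g j ≤ s := fun i hi => hi
  choose f hfS hfi hfj using hJ'
  classical
  have hJ : #J < κ := h.mk_lt_of_strictMonoOn (g := fun i => if hi : i ∈ J then f i hi else g i)
    (fun i hi j hj hij => by
      simpa only [dif_pos hi, dif_pos hj] using (hfi i hi).trans_le (hfj j hj i hij))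
    (fun i hi => by simpa only [dif_pos hi] using hfS i hi)
  obtain ⟨i₀, hi₀⟩ := exists_forall_lt_of_mk_lt hκ hJ
  refine ⟨i₀, fun i hi s hs hsi => ?_⟩
  obtain ⟨k, hk, -⟩ := exists_gt_toType hκ i i
  have hne : {j | s < g j}.Nonempty := ⟨k, hsi.2.trans_lt (hg hk)⟩
  obtain ⟨j, hj, hmin⟩ := WellFounded.has_min (wellFounded_lt (α := κ.ord.ToType)) _ hne
  have hjJ : j ∈ J := ⟨s, hs, hj, fun j' hj' => not_lt.1 fun hlt => hmin j' hlt hj'⟩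
  have := hg (hi₀ j hjJ)
  exact absurd hsi.1 (not_le.2 (lt_trans hj this))

end Chains

/-! ### Chains of elements and chains of archimedean classes -/

section ClassChains

open ArchimedeanClass

variable {K : Type u} [Field K] [LinearOrder K] [IsStrictOrderedRing K] {κ : Cardinal.{u}}

/-- The archimedean classes of the nonzero elements of `E`. -/
def classes (E : Subfield K) : Set (ArchimedeanClass K) :=
  {γ | ∃ y ∈ E, y ≠ 0 ∧ ArchimedeanClass.mk y = γ}

/-- In a κ-chain `g`, the class of g j - g i falls as j grows and so stabilizes (`h₂`). The stable
class rises with i and so stabilizes as well (`h₁`). From then on the chain lives on a single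
archimedean scale, where differences compare with rational multiples of a fixed `d`, and only
countably many rationals are available to separate κ members. -/
theorem noChain_of_noChain_classes (hκ : κ.IsRegular) (hκ0 : ℵ₀ < κ) {E : Subfield K}
    (h₁ : NoChain κ (classes E))
    (h₂ : NoChain κ (α := (ArchimedeanClass K)ᵒᵈ) (OrderDual.ofDual ⁻¹' classes E)) :
    NoChain κ (E : Set K) := by
  by_contra hE
  obtain ⟨g, hg, hgE⟩ := exists_strictMono_of_not_noChain hE
  have hdiff : ∀ i j, i < j → ArchimedeanClass.mk (g j - g i) ∈ classes E := fun i j hij =>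
    ⟨_, sub_mem (hgE j) (hgE i), (sub_pos.2 (hg hij)).ne', rfl⟩
  have hanti : ∀ {x y : K}, 0 < x → x ≤ y → ArchimedeanClass.mk y ≤ ArchimedeanClass.mk x :=
    fun hx hxy => mk_antitoneOn hx.le (hx.le.trans hxy) hxy
  have hρ : ∀ i, ∃ r > i, ∀ j ≥ r,
      ArchimedeanClass.mk (g j - g i) = ArchimedeanClass.mk (g r - g i) := by
    intro i
    obtain ⟨i', hi', -⟩ := exists_gt_toType hκ i i
    obtain ⟨r, hr, hrj⟩ := h₂.eventually_const hκ
      (f := fun j => OrderDual.toDual (ArchimedeanClass.mk (g j - g i))) i'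
      (fun j hj k hk hjk => OrderDual.toDual_le_toDual.2
        (hanti (sub_pos.2 (hg (hi'.trans_le hj))) (sub_le_sub_right (hg.monotone hjk) _)))
      (fun j hj => hdiff i j (hi'.trans_le hj))
    exact ⟨r, hi'.trans_le hr, fun j hj => OrderDual.toDual.injective (hrj j hj)⟩
  choose ρ hρi hρ using hρ
  have hne : Nonempty κ.ord.ToType := by
    rw [← mk_ne_zero_iff, mk_ord_toType]
    exact hκ.ne_zero
  obtain ⟨i₁, -, hi₁⟩ := h₁.eventually_const hκ
    (f := fun i => ArchimedeanClass.mk (g (ρ i) - g i)) (Classical.arbitrary _)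
    (fun i _ j _ hij => by
      show ArchimedeanClass.mk (g (ρ i) - g i) ≤ ArchimedeanClass.mk (g (ρ j) - g j)
      rw [← hρ i _ (le_max_left (ρ i) (ρ j)), ← hρ j _ (le_max_right (ρ i) (ρ j))]
      exact hanti (sub_pos.2 (hg ((hρi j).trans_le (le_max_right _ _))))
        (sub_le_sub_left (hg.monotone hij) _))
    (fun i _ => hdiff _ _ (hρi i))
  set d := g (ρ i₁) - g i₁ with hd
  have hd0 : 0 < d := sub_pos.2 (hg (hρi i₁))
  -- For each rational q, an index by which the chain has passed q·d if it ever does. Countably many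
  -- such indices are bounded since κ is regular and uncountable.
  have hq : ∀ q : ℚ, ∃ i, (∃ j, q * d < g j - g i₁) → q * d < g i - g i₁ := by
    intro q
    by_cases h : ∃ j, q * d < g j - g i₁
    · exact ⟨h.choose, fun _ => h.choose_spec⟩
    · exact ⟨i₁, fun h' => absurd h' h⟩
  choose b hb using hq
  obtain ⟨i', hi'⟩ := exists_forall_lt_of_mk_lt hκ (J := Set.range b)
    ((mk_le_aleph0_iff.2 (Set.countable_range b).to_subtype).trans_lt hκ0)
  obtain ⟨i, hi, hii⟩ := exists_gt_toType hκ i' i₁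
  have hstable : ∀ q : ℚ, ∀ j, q * d < g j - g i₁ → q * d < g i - g i₁ := fun q j hj =>
    (hb q ⟨j, hj⟩).trans (sub_lt_sub_right (hg ((hi' _ ⟨q, rfl⟩).trans hi)) _)
  have hmk : ArchimedeanClass.mk (g (ρ i) - g i) = ArchimedeanClass.mk d := hi₁ i hii.le
  have he0 : 0 < g (ρ i) - g i := sub_pos.2 (hg (hρi i))
  obtain ⟨N, hN⟩ := mk_le_mk.1 hmk.le
  rw [abs_of_pos hd0, abs_of_pos he0, nsmul_eq_mul] at hN
  have hN0 : (0 : K) < N := pos_of_mul_pos_left (hd0.trans_le hN) he0.le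
  obtain ⟨M, hM⟩ : ∃ M : ℕ, g i - g i₁ ≤ M * d := by
    have h1 := hρ i₁ _ (le_max_left (ρ i₁) i)
    obtain ⟨M, hM⟩ := mk_le_mk.1 h1.ge
    rw [abs_of_pos hd0, nsmul_eq_mul] at hM
    exact ⟨M, (sub_le_sub_right (hg.monotone (le_max_right _ _)) _).trans
      ((le_abs_self _).trans hM)⟩
  -- The step from `g i` to `g (ρ i)` is at least d/N, twice the mesh d/(2N). So the first grid
  -- point k·d/(2N) past g i - g i₁ is also passed by g (ρ i) - g i₁, although the chain should pass
  -- no further rational multiple of `d` after `i`.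
  have hex : ∃ k : ℕ, (g i - g i₁) * (2 * N) < k * d := by
    refine ⟨M * (2 * N) + 1, ?_⟩
    push_cast
    nlinarith
  classical
  obtain ⟨k, hk, hmin⟩ : ∃ k : ℕ, (g i - g i₁) * (2 * N) < k * d ∧
      ∀ m < k, ¬ (g i - g i₁) * (2 * N) < m * d :=
    ⟨Nat.find hex, Nat.find_spec hex, fun m => Nat.find_min hex⟩
  have hgi : 0 < g i - g i₁ := sub_pos.2 (hg hii)
  have hk0 : k ≠ 0 := by
    rintro rfl
    simp only [Nat.cast_zero, zero_mul] at hk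
    exact absurd hk (not_lt.2 (by positivity))
  obtain ⟨m, rfl⟩ := Nat.exists_eq_succ_of_ne_zero hk0
  have hm := not_lt.1 (hmin m (Nat.lt_succ_self m))
  push_cast at hk
  have h2N : (0 : K) < 2 * N := by positivity
  have key := hstable ((m + 1) / (2 * N)) (ρ i) (by
    push_cast
    rw [div_mul_eq_mul_div, div_lt_iff₀ h2N]
    nlinarith)
  push_cast at key
  rw [div_mul_eq_mul_div, div_lt_iff₀ h2N] at key
  exact lt_asymm hk key

theorem nsmul_lt_nsmul_of_lt {γ δ : ArchimedeanClass K} (h : γ < δ) {n : ℕ} (hn : 0 < n) :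
    n • γ < n • δ := by
  induction γ using ArchimedeanClass.ind with | mk x => ?_
  induction δ using ArchimedeanClass.ind with | mk y => ?_
  rw [← mk_pow, ← mk_pow, mk_lt_mk]
  rw [mk_lt_mk] at h
  intro N
  have h1 := h (N + 1)
  rw [nsmul_eq_mul] at h1 ⊢
  rw [abs_pow, abs_pow]
  have hN : (1 : K) ≤ (N + 1 : ℕ) := by push_cast; linarith [Nat.cast_nonneg (α := K) N]
  calc (N : K) * |y| ^ n ≤ (N + 1 : ℕ) * |y| ^ n := by
        gcongr
        exact Nat.le_succ N
    _ ≤ ((N + 1 : ℕ) : K) ^ n * |y| ^ n := by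
        gcongr
        exact le_self_pow₀ hN hn.ne'
    _ = ((N + 1 : ℕ) * |y|) ^ n := (mul_pow _ _ _).symm
    _ < |x| ^ n := pow_lt_pow_left₀ h1 (by positivity) hn.ne'

/-- Each class γ of the extension satisfies nγ = m·v(x) + v(c) with `c` in `F`. In a κ-chain of
classes, one pair (n, m) occurs κ times, and the corresponding |c| are then strictly monotone in
`F`; a change of sign handles increasing classes. -/
theorem noChain_realClosureIn_union_singleton (hκ : κ.IsRegular) (hκ0 : ℵ₀ < κ) {F : Subfield K}
    (hF : NoChain κ (F : Set K)) (a : K) :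
    NoChain κ (realClosureIn ((F : Set K) ∪ {a}) : Set K) := by
  obtain ⟨x, hx0, hx⟩ := exists_forall_mk_pow_eq F a
  have key : ∀ f : κ.ord.ToType → ArchimedeanClass K,
      (∀ i, f i ∈ classes (realClosureIn ((F : Set K) ∪ {a}))) →
      ∃ n : ℕ, 0 < n ∧ ∃ J : Set κ.ord.ToType, κ ≤ #J ∧ ∃ c : κ.ord.ToType → K,
        ∃ z : ArchimedeanClass K, ∀ i, c i ∈ F ∧ (i ∈ J → n • f i = z + ArchimedeanClass.mk (c i)) := by
    intro f hf
    choose y hy hy0 hyf using hf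
    choose n hn m c hc hc0 h using fun i => hx (y i) (hy i) (hy0 i)
    obtain ⟨⟨⟨n₀⟩, ⟨m₀⟩⟩, h₀⟩ := infinite_pigeonhole_card
      (fun i => ((ULift.up (n i), ULift.up (m i)) : ULift.{u} ℕ × ULift.{u} ℤ)) κ
      (mk_ord_toType κ).ge hκ.aleph0_le (by
        rw [hκ.cof_ord]
        exact (mk_le_aleph0 (α := ULift.{u} ℕ × ULift.{u} ℤ)).trans_lt hκ0)
    have hmem : ∀ i ∈ (fun i => ((ULift.up (n i), ULift.up (m i)) : ULift.{u} ℕ × ULift.{u} ℤ)) ⁻¹'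
        {(ULift.up n₀, ULift.up m₀)}, n i = n₀ ∧ m i = m₀ := fun i hi => by
      simpa using hi
    have hnonempty : ∃ i, n i = n₀ ∧ m i = m₀ := by
      have : #((fun i => ((ULift.up (n i), ULift.up (m i)) : ULift.{u} ℕ × ULift.{u} ℤ)) ⁻¹'
        {(ULift.up n₀, ULift.up m₀)}) ≠ 0 := (hκ.pos.trans_le h₀).ne'
      rw [mk_ne_zero_iff] at this
      obtain ⟨i, hi⟩ := this
      exact ⟨i, hmem i hi⟩
    obtain ⟨i₀, rfl, rfl⟩ := hnonempty
    refine ⟨n i₀, hn i₀, _, h₀, c, ArchimedeanClass.mk (x ^ m i₀),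
      fun i => ⟨hc i, fun hi => ?_⟩⟩
    obtain ⟨h1, h2⟩ := hmem i hi
    rw [← mk_mul, ← h2, ← h i, ← h1, mk_pow, hyf]
  have hlt : ∀ {n : ℕ} {γ δ z : ArchimedeanClass K} {c c' : K}, γ < δ →
      n • γ = z + ArchimedeanClass.mk c → n • δ = z + ArchimedeanClass.mk c' → 0 < n →
      |c'| < |c| := by
    intro n γ δ z c c' hγδ h1 h2 hn
    have h3 : ArchimedeanClass.mk c < ArchimedeanClass.mk c' := by
      have := nsmul_lt_nsmul_of_lt hγδ hn
      rw [h1, h2] at this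
      exact lt_of_add_lt_add_left this
    simpa using mk_lt_mk.1 h3 1
  refine noChain_of_noChain_classes hκ hκ0 ?_ ?_
  · by_contra hno
    obtain ⟨f, hf, hfE⟩ := exists_strictMono_of_not_noChain hno
    obtain ⟨n, hn, J, hJ, c, z, hc⟩ := key f hfE
    refine (hF.mk_lt_of_strictMonoOn (J := J) (g := fun i => -|c i|) (fun i hi j hj hij => ?_)
      fun i hi => ?_).not_ge hJ
    · exact neg_lt_neg (hlt (hf hij) ((hc i).2 hi) ((hc j).2 hj) hn)
    · rcases abs_choice (c i) with h | h <;> simp [h, (hc i).1]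
  · by_contra hno
    obtain ⟨f, hf, hfE⟩ := exists_strictMono_of_not_noChain hno
    obtain ⟨n, hn, J, hJ, c, z, hc⟩ := key (fun i => OrderDual.ofDual (f i)) hfE
    refine (hF.mk_lt_of_strictMonoOn (J := J) (g := fun i => |c i|) (fun i hi j hj hij => ?_)
      fun i hi => ?_).not_ge hJ
    · exact hlt (OrderDual.ofDual_lt_ofDual.2 (hf hij)) ((hc j).2 hj) ((hc i).2 hi) hn
    · rcases abs_choice (c i) with h | h <;> simp [h, (hc i).1]

theorem noChain_realClosureIn_union_finset (hκ : κ.IsRegular) (hκ0 : ℵ₀ < κ) {F : Subfield K}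
    (hF : NoChain κ (F : Set K)) (t : Finset K) :
    NoChain κ (realClosureIn ((F : Set K) ∪ t) : Set K) := by
  classical
  induction t using Finset.induction_on with
  | empty =>
    -- `F` need not be relatively algebraically closed, so even with nothing adjoined the
    -- one-element case is needed, here with the dummy generator 0.
    refine (noChain_realClosureIn_union_singleton hκ hκ0 hF 0).mono ?_
    exact realClosureIn_mono (by simp)
  | insert a t ha ih =>
    have := noChain_realClosureIn_union_singleton hκ hκ0 ih a
    rw [realClosureIn_union_left] at this
    convert this using 3
    ext
    simp

end ClassChains

/-! ### Signs of polynomials over real closed fields -/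

section Signs

open SignType

variable {A : Type*} [Field A] [LinearOrder A] [IsStrictOrderedRing A]

theorem mul_eval_pos_of_forall_ne_zero [IsRealClosed A] {q : A[X]} {x y : A} (hxy : x < y)
    (hx : q.eval x ≠ 0) (hy : q.eval y ≠ 0) (h : ∀ z, x < z → z < y → q.eval z ≠ 0) :
    0 < q.eval x * q.eval y := by
  by_contra hno
  obtain ⟨z, h1, h2, h3⟩ := exists_root_of_eval_mul_eval_neg hxy
    (lt_of_le_of_ne (not_lt.1 hno) (mul_ne_zero hx hy))
  exact h z h1 h2 h3

theorem sign_eq_of_mul_pos {x y : A} (h : 0 < x * y) : sign x = sign y := by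
  rcases pos_and_pos_or_neg_and_neg_of_mul_pos h with ⟨h1, h2⟩ | ⟨h1, h2⟩
  · rw [sign_pos h1, sign_pos h2]
  · rw [sign_neg h1, sign_neg h2]

theorem sign_eval_eq_of_forall_ne_zero [IsRealClosed A] {q : A[X]} (h : ∀ z, q.eval z ≠ 0)
    (x y : A) :
    sign (q.eval x) = sign (q.eval y) := by
  rcases lt_trichotomy x y with hxy | rfl | hxy
  · exact sign_eq_of_mul_pos
      (mul_eval_pos_of_forall_ne_zero hxy (h _) (h _) fun z _ _ => h z)
  · rfl
  · exact (sign_eq_of_mul_pos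
      (mul_eval_pos_of_forall_ne_zero hxy (h _) (h _) fun z _ _ => h z)).symm

/-- Rolle's theorem: between two roots of a polynomial, its derivative vanishes. -/
theorem exists_eval_derivative_eq_zero [IsRealClosed A] {p : A[X]} {a b : A} (hab : a < b)
    (ha : p.eval a = 0) (hb : p.eval b = 0) : ∃ z, a ≤ z ∧ z ≤ b ∧ p.derivative.eval z = 0 := by
  by_contra! hno
  have hp : p ≠ 0 := by
    rintro rfl
    exact hno a le_rfl hab.le (by simp)
  -- With c the next root after a, p = (X - a)(X - c)q and q has constant sign from a to c. So p'
  -- takes the values (a - c)q(a) and (c - a)q(c), of opposite signs.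
  obtain ⟨c, hc, hmin⟩ := (p.roots.toFinset.filter fun z => a < z ∧ z ≤ b).exists_min_image id
    ⟨b, by simp [hp, hb, hab]⟩
  simp only [Finset.mem_filter, Multiset.mem_toFinset, mem_roots hp, IsRoot.def, id,
    and_imp] at hc hmin
  obtain ⟨hc0, hac, hcb⟩ := hc
  obtain ⟨r, hr⟩ := dvd_iff_isRoot.2 ha
  have hrc : r.eval c = 0 := by
    rw [hr, eval_mul] at hc0
    exact (mul_eq_zero.1 hc0).resolve_left (by simpa [sub_eq_zero] using hac.ne')
  obtain ⟨q, hq⟩ := dvd_iff_isRoot.2 hrc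
  have hpq : p = (X - C a) * ((X - C c) * q) := by rw [hr, hq]
  have ha' : p.derivative.eval a = (a - c) * q.eval a := by rw [hpq]; simp
  have hc' : p.derivative.eval c = (c - a) * q.eval c := by rw [hpq]; simp
  have hqa : q.eval a ≠ 0 := fun h => hno a le_rfl hab.le (by rw [ha', h, mul_zero])
  have hqc : q.eval c ≠ 0 := fun h => hno c hac.le hcb (by rw [hc', h, mul_zero])
  have hpos := mul_eval_pos_of_forall_ne_zero hac hqa hqc fun z h1 h2 h3 =>
    absurd (hmin z (by rw [hpq]; simp [h3]) h1 (h2.le.trans hcb)) (not_le.2 h2)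
  obtain ⟨z, h1, h2, h3⟩ := exists_root_of_eval_mul_eval_neg (p := p.derivative) hac (by
    rw [ha', hc']
    nlinarith [mul_pos (mul_pos (sub_pos.2 hac) (sub_pos.2 hac)) hpos])
  exact hno z h1.le (h2.le.trans hcb) h3

/-- By Rolle α is the only root between x and y, and it is simple. The cofactor of X - α therefore
keeps its sign. -/
theorem mul_eval_neg_of_derivative_ne_zero [IsRealClosed A] {p : A[X]} {x y α : A} (hx : x < α)
    (hy : α < y) (hα : p.eval α = 0) (hpx : p.eval x ≠ 0) (hpy : p.eval y ≠ 0)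
    (h : ∀ z, x < z → z < y → p.derivative.eval z ≠ 0) : p.eval x * p.eval y < 0 := by
  obtain ⟨q, hq⟩ := dvd_iff_isRoot.2 hα
  have hpe : ∀ z, p.eval z = (z - α) * q.eval z := fun z => by rw [hq]; simp
  have hα' : p.derivative.eval α = q.eval α := by rw [hq]; simp
  have hqz : ∀ z, x < z → z < y → q.eval z ≠ 0 := by
    intro z h1 h2 h3
    have hz : p.eval z = 0 := by rw [hpe, h3, mul_zero]
    rcases lt_trichotomy z α with hlt | rfl | hlt
    · obtain ⟨w, hw1, hw2, hw3⟩ := exists_eval_derivative_eq_zero hlt hz hα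
      exact h w (h1.trans_le hw1) (hw2.trans_lt hy) hw3
    · exact h _ hx hy (hα'.trans h3)
    · obtain ⟨w, hw1, hw2, hw3⟩ := exists_eval_derivative_eq_zero hlt hα hz
      exact h w (hx.trans_le hw1) (hw2.trans_lt h2) hw3
  have hpos := mul_eval_pos_of_forall_ne_zero (hx.trans hy)
    (fun h0 => hpx (by rw [hpe, h0, mul_zero])) (fun h0 => hpy (by rw [hpe, h0, mul_zero])) hqz
  rw [hpe, hpe]
  nlinarith [mul_pos (mul_pos (sub_pos.2 hx) (sub_pos.2 hy)) hpos]

end Signs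

/-! ### Extending order-preserving correspondences to algebraic elements -/

section Extension

open SignType

variable {A A' : Type*} [Field A] [Field A']
  {k : Type*} [Field k] {f : k →+* A} {g : k →+* A'} {n : ℕ}

/-- Roots in `A` of nonzero polynomials over `k` of degree less than `n` come from `k`. -/
def RootsInRange (f : k →+* A) (n : ℕ) : Prop :=
  ∀ p : k[X], p ≠ 0 → p.natDegree < n → ∀ x, p.eval₂ f x = 0 → x ∈ Set.range f

theorem eval₂_ne_zero_of_forall_eval_ne_zero (hf : RootsInRange f n) {p : k[X]}
    (hn : p.natDegree < n) (hp : ∀ c, p.eval c ≠ 0) (z : A) : (p.map f).eval z ≠ 0 := by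
  intro h
  rw [eval_map] at h
  obtain ⟨c, rfl⟩ := hf p (by rintro rfl; exact hp 0 (by simp)) hn z h
  rw [eval₂_at_apply, map_eq_zero] at h
  exact hp c h

variable [LinearOrder A] [LinearOrder A']

/-- Roots in `k` split off as linear factors, whose signs `hxy` controls. A factor without roots in
`k` has none in `A` or `A'` either, so its sign is constant and can be read off at 0. -/
theorem sign_eval₂_eq [IsStrictOrderedRing A] [IsRealClosed A]
    [IsStrictOrderedRing A'] [IsRealClosed A'] (hfg : ∀ c, sign (f c) = sign (g c))
    (hf : RootsInRange f n)
    (hg : RootsInRange g n) {x : A} {y : A'} (hxy : ∀ c, sign (x - f c) = sign (y - g c))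
    (p : k[X]) (hp : p.natDegree < n) : sign (p.eval₂ f x) = sign (p.eval₂ g y) := by
  induction hd : p.natDegree using Nat.strong_induction_on generalizing p with
  | h d ih =>
    by_cases hp0 : p = 0
    · simp [hp0]
    by_cases hroot : ∃ c, p.eval c = 0
    · obtain ⟨c, hc⟩ := hroot
      obtain ⟨q, hq⟩ := dvd_iff_isRoot.2 hc
      have hq0 : q ≠ 0 := by rintro rfl; simp [hq] at hp0
      have hdeg : p.natDegree = q.natDegree + 1 := by
        rw [hq, natDegree_mul (X_sub_C_ne_zero c) hq0, natDegree_X_sub_C, add_comm]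
      have := ih q.natDegree (by omega) q (by omega) rfl
      rw [hq, eval₂_mul, eval₂_mul, sign_mul, sign_mul, this]
      simp [hxy]
    · push Not at hroot
      have h1 := sign_eval_eq_of_forall_ne_zero
        (eval₂_ne_zero_of_forall_eval_ne_zero hf hp hroot) x (f 0)
      have h2 := sign_eval_eq_of_forall_ne_zero
        (eval₂_ne_zero_of_forall_eval_ne_zero hg hp hroot) y (g 0)
      rw [eval_map, eval_map, eval₂_at_apply] at h1 h2
      rw [h1, h2, hfg]

/-- If |α| > 1, then |α| is at most some power |α|^n that has the archimedean class of an element of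
`k`. -/
theorem exists_lt_and_gt_of_eval₂_eq_zero [IsStrictOrderedRing A] (p : k[X]) (hp : p ≠ 0) {α : A}
    (hα : p.eval₂ f α = 0) : ∃ c d, f c < α ∧ α < f d := by
  suffices h : ∃ d, |α| < f d by
    obtain ⟨d, hd⟩ := h
    obtain ⟨h1, h2⟩ := abs_lt.1 hd
    exact ⟨-d, d, by rwa [map_neg], h2⟩
  rcases le_or_gt |α| 1 with h1 | h1
  · exact ⟨2, by rw [map_ofNat]; linarith⟩
  have hα0 : α ≠ 0 := by
    rintro rfl
    norm_num at h1
  have hmem : α ∈ realClosureIn (Set.range f) := by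
    refine mem_realClosureIn_of_coeff_mem (p := p.map f) (Polynomial.map_ne_zero hp)
      (fun n => subset_realClosureIn ⟨_, (coeff_map f n).symm⟩) (by rwa [eval_map])
  obtain ⟨n, hn, c, hc, -, h⟩ := exists_mk_pow_eq_of_mem_realClosureIn hmem hα0
  rw [← RingHom.coe_fieldRange, Subfield.closure_eq] at hc
  obtain ⟨c, rfl⟩ := hc
  obtain ⟨N, hN⟩ := ArchimedeanClass.mk_le_mk.1 h.ge
  rw [abs_pow, nsmul_eq_mul] at hN
  have h2 : |α| ≤ |α| ^ n := le_self_pow₀ h1.le hn.ne'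
  rcases abs_choice (f c) with h3 | h3
  · exact ⟨N * c + 1, by rw [map_add, map_mul, map_natCast, map_one]; rw [h3] at hN; linarith⟩
  · exact ⟨-(N * c) + 1, by
      rw [map_add, map_neg, map_mul, map_natCast, map_one]; rw [h3] at hN; linarith⟩

theorem lt_iff_lt_of_sign [IsStrictOrderedRing A] [IsStrictOrderedRing A']
    (hfg : ∀ c, sign (f c) = sign (g c)) (c d : k) :
    f c < f d ↔ g c < g d := by
  have := hfg (d - c)
  rw [f.map_sub, g.map_sub] at this
  rw [← sub_pos, ← sub_pos (a := g d), ← sign_eq_one_iff, this, sign_eq_one_iff]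

/-- A root of minimal degree has a counterpart on the other side that realizes the same cut. -/
theorem exists_root_sameCut [IsStrictOrderedRing A] [IsRealClosed A]
    [IsStrictOrderedRing A'] [IsRealClosed A'] (hfg : ∀ c, sign (f c) = sign (g c))
    (hf : RootsInRange f n)
    {p : k[X]} (hp : p ≠ 0) (hn : p.natDegree = n) {α : A}
    (hα : p.eval₂ f α = 0) (hαf : α ∉ Set.range f) :
    ∃ β, p.eval₂ g β = 0 ∧ ∀ c, sign (α - f c) = sign (β - g c) := by
  classical
  have hne : ∀ c, α ≠ f c := fun c h => hαf ⟨c, h.symm⟩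
  have hnoroot : ∀ c, p.eval c ≠ 0 := by
    intro c hc
    obtain ⟨q, hq⟩ := dvd_iff_isRoot.2 hc
    have hq0 : q ≠ 0 := by rintro rfl; simp [hq] at hp
    have hdeg : p.natDegree = q.natDegree + 1 := by
      rw [hq, natDegree_mul (X_sub_C_ne_zero c) hq0, natDegree_X_sub_C, add_comm]
    refine hαf (hf q hq0 (by omega) α ?_)
    rw [hq, eval₂_mul] at hα
    refine (mul_eq_zero.1 hα).resolve_left ?_
    simpa [sub_eq_zero] using hne c
  have hchar : CharZero k := (RingHom.charZero_iff f.injective).2 inferInstance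
  have hn0 : n ≠ 0 := by
    intro h0
    obtain ⟨c, rfl⟩ := natDegree_eq_zero.1 (hn.trans h0)
    rw [eval₂_C, map_eq_zero] at hα
    simp [hα] at hp
  have hder : p.derivative ≠ 0 := fun h => hn0 (hn ▸ derivative_eq_zero.1 h)
  have hder' : p.derivative.natDegree < n := hn ▸ natDegree_derivative_lt (hn ▸ hn0)
  by_contra! hno
  choose! s hs using hno
  obtain ⟨c₀, d₀, hc₀, hd₀⟩ := exists_lt_and_gt_of_eval₂_eq_zero p hp hα
  -- `T` contains bounds for α, the roots of p' in `k`, and for every root β of `p` in `A'` a point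
  -- `s β` at which β fails to match α. Between the neighbours `lo`, `hi` of α in `T` the sign of
  -- `p` changes, so `A'` has a root β between their images. But `s β` lies outside that interval,
  -- where α and β do agree.
  set T : Finset k := insert c₀ (insert d₀
    (p.derivative.roots.toFinset ∪ (p.map g).roots.toFinset.image s)) with hT
  obtain ⟨lo, hlo, hlomax⟩ := (T.filter fun c => f c < α).exists_max_image f
    ⟨c₀, by simp [hT, hc₀]⟩
  obtain ⟨hi, hhi, hhimin⟩ := (T.filter fun c => α < f c).exists_min_image f
    ⟨d₀, by simp [hT, hd₀]⟩
  simp only [Finset.mem_filter, and_imp] at hlo hlomax hhi hhimin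
  have hTout : ∀ c ∈ T, f c ≤ f lo ∨ f hi ≤ f c := fun c hc =>
    (lt_or_gt_of_ne (hne c)).symm.imp (hlomax c hc) (hhimin c hc)
  have hneg : (p.map f).eval (f lo) * (p.map f).eval (f hi) < 0 := by
    refine mul_eval_neg_of_derivative_ne_zero hlo.2 hhi.2 (by rwa [eval_map]) ?_ ?_ ?_
    · rw [eval_map, eval₂_at_apply]
      simpa using hnoroot lo
    · rw [eval_map, eval₂_at_apply]
      simpa using hnoroot hi
    · intro z h1 h2 h3
      rw [derivative_map, eval_map] at h3
      obtain ⟨c, rfl⟩ := hf _ hder hder' z h3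
      rw [eval₂_at_apply, map_eq_zero] at h3
      rcases hTout c (by simp [hT, hder, h3]) with h | h
      · exact absurd h1 (not_lt.2 h)
      · exact absurd h2 (not_lt.2 h)
  have hneg' : (p.map g).eval (g lo) * (p.map g).eval (g hi) < 0 := by
    rw [eval_map, eval_map, eval₂_at_apply, eval₂_at_apply, ← map_mul] at hneg ⊢
    rwa [← sign_eq_neg_one_iff, ← hfg, sign_eq_neg_one_iff]
  have hlohi : g lo < g hi := (lt_iff_lt_of_sign hfg lo hi).1 (hlo.2.trans hhi.2)
  obtain ⟨β, h1, h2, h3⟩ := exists_root_of_eval_mul_eval_neg hlohi hneg'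
  have h4 := hs β (by rwa [eval_map] at h3)
  rcases hTout (s β) (by
    have : p.map g ≠ 0 := Polynomial.map_ne_zero hp
    simp only [hT, Finset.mem_insert, Finset.mem_union, Finset.mem_image, Multiset.mem_toFinset]
    exact Or.inr (Or.inr (Or.inr ⟨β, (mem_roots this).2 h3, rfl⟩))) with h | h
  · refine h4 ?_
    have h' : g (s β) ≤ g lo := not_lt.1 fun hlt => h.not_gt ((lt_iff_lt_of_sign hfg _ _).2 hlt)
    rw [sign_pos (sub_pos.2 (h.trans_lt hlo.2)), sign_pos (sub_pos.2 (h'.trans_lt h1))]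
  · refine h4 ?_
    have h' : g hi ≤ g (s β) := not_lt.1 fun hlt => h.not_gt ((lt_iff_lt_of_sign hfg _ _).2 hlt)
    rw [sign_neg (sub_neg.2 (hhi.2.trans_le h)), sign_neg (sub_neg.2 (h2.trans_le h'))]

/-- A subring of `A × A'` is sign-compatible if the two components of its members have the same
sign: it is the graph of an order isomorphism between subrings. -/
def SignCompatible (S : Subring (A × A')) : Prop := ∀ x ∈ S, sign x.1 = sign x.2

/-- Reduction modulo `p` leaves degree below `n`, where `sign_eval₂_eq` applies. -/
theorem sign_eval₂_eq_of_natDegree_le [IsStrictOrderedRing A] [IsRealClosed A]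
    [IsStrictOrderedRing A'] [IsRealClosed A'] (hfg : ∀ c, sign (f c) = sign (g c))
    (hf : RootsInRange f n) (hg : RootsInRange g n) {p : k[X]} (hn : p.natDegree = n)
    (hn0 : p.natDegree ≠ 0)
    {α : A} {β : A'} (hα : p.eval₂ f α = 0) (hβ : p.eval₂ g β = 0)
    (hcut : ∀ c, sign (α - f c) = sign (β - g c)) (q : k[X]) :
    sign (q.eval₂ f α) = sign (q.eval₂ g β) := by
  have h := EuclideanDomain.div_add_mod q p
  have e1 : q.eval₂ f α = (q % p).eval₂ f α := by
    conv_lhs => rw [← h]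
    rw [eval₂_add, eval₂_mul, hα, zero_mul, zero_add]
  have e2 : q.eval₂ g β = (q % p).eval₂ g β := by
    conv_lhs => rw [← h]
    rw [eval₂_add, eval₂_mul, hβ, zero_mul, zero_add]
  rw [e1, e2]
  exact sign_eval₂_eq hfg hf hg hcut _ (hn ▸ natDegree_mod_lt q hn0)

theorem exists_maximal_signCompatible {S₀ : Subring (A × A')} (h₀ : SignCompatible S₀) :
    ∃ S, S₀ ≤ S ∧ Maximal SignCompatible S := by
  refine zorn_le_nonempty₀ {S | SignCompatible S} ?_ S₀ h₀
  intro c hc hchain S hS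
  refine ⟨sSup c, ?_, fun T hT => le_sSup hT⟩
  intro x hx
  obtain ⟨T, hT, hxT⟩ := (Subring.mem_sSup_of_directedOn ⟨S, hS⟩ hchain.directedOn).1 hx
  exact hc hT x hxT

theorem SignCompatible.fst_eq_zero_iff {S : Subring (A × A')} (hS : SignCompatible S)
    {x : A × A'} (hx : x ∈ S) : x.1 = 0 ↔ x.2 = 0 := by
  rw [← sign_eq_zero_iff, hS x hx, sign_eq_zero_iff]

/-- Admitting fractions with denominators in `S` preserves sign compatibility, as signs are
multiplicative. Maximality then leaves nothing to add. -/
theorem inv_mem_of_maximal [IsStrictOrderedRing A] [IsStrictOrderedRing A']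
    {S : Subring (A × A')} (hS : Maximal SignCompatible S) {x : A × A'}
    (hx : x ∈ S) (hx0 : x.1 ≠ 0) : x⁻¹ ∈ S := by
  let S' : Subring (A × A') :=
    { carrier := {u | ∃ s ∈ S, s.1 ≠ 0 ∧ s * u ∈ S}
      mul_mem' := by
        rintro u v ⟨s, hs, hs0, hsu⟩ ⟨t, ht, ht0, htv⟩
        exact ⟨s * t, mul_mem hs ht, mul_ne_zero hs0 ht0, by
          rw [mul_mul_mul_comm]; exact mul_mem hsu htv⟩
      one_mem' := ⟨1, one_mem _, one_ne_zero, by simp [one_mem]⟩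
      add_mem' := by
        rintro u v ⟨s, hs, hs0, hsu⟩ ⟨t, ht, ht0, htv⟩
        refine ⟨s * t, mul_mem hs ht, mul_ne_zero hs0 ht0, ?_⟩
        have : s * t * (u + v) = t * (s * u) + s * (t * v) := by ring
        rw [this]
        exact add_mem (mul_mem ht hsu) (mul_mem hs htv)
      zero_mem' := ⟨1, one_mem _, one_ne_zero, by simp [zero_mem]⟩
      neg_mem' := by
        rintro u ⟨s, hs, hs0, hsu⟩
        exact ⟨s, hs, hs0, by rw [mul_neg]; exact neg_mem hsu⟩ }
  have hS' : SignCompatible S' := by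
    rintro u ⟨s, hs, hs0, hsu⟩
    have h1 := hS.prop _ hsu
    rw [Prod.fst_mul, Prod.snd_mul, sign_mul, sign_mul, ← hS.prop s hs] at h1
    exact mul_left_cancel₀ (sign_ne_zero.2 hs0) h1
  have hle : S ≤ S' := fun u hu => ⟨1, one_mem _, one_ne_zero, by rwa [one_mul]⟩
  refine hS.le_of_ge hS' hle ⟨x, hx, hx0, ?_⟩
  have hx2 : x.2 ≠ 0 := fun h => hx0 ((hS.prop.fst_eq_zero_iff hx).2 h)
  have : x * x⁻¹ = 1 := Prod.ext (mul_inv_cancel₀ hx0) (mul_inv_cancel₀ hx2)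
  rw [this]
  exact one_mem _

/-- The domain of a maximal sign-compatible subring is relatively algebraically closed. -/
theorem exists_mem_of_maximal [IsStrictOrderedRing A] [IsRealClosed A]
    [IsStrictOrderedRing A'] [IsRealClosed A'] {S : Subring (A × A')}
    (hS : Maximal SignCompatible S)
    {p : A[X]} (hp : p ≠ 0) (hcoeff : ∀ n, ∃ s ∈ S, s.1 = p.coeff n) {α : A}
    (hα : p.eval α = 0) : ∃ s ∈ S, s.1 = α := by
  classical
  have hfield : IsField S :=
    { exists_pair_ne := ⟨0, 1, by
        intro h
        have := congrArg (fun s : S => s.1.1) h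
        simp at this⟩
      mul_comm := mul_comm
      mul_inv_cancel := by
        intro s hs
        have h1 : s.1.1 ≠ 0 := fun h => hs
          (Subtype.ext (Prod.ext h ((hS.prop.fst_eq_zero_iff s.2).1 h)))
        have h2 : s.1.2 ≠ 0 := fun h => h1 ((hS.prop.fst_eq_zero_iff s.2).2 h)
        exact ⟨⟨_, inv_mem_of_maximal hS s.2 h1⟩,
          Subtype.ext (Prod.ext (mul_inv_cancel₀ h1) (mul_inv_cancel₀ h2))⟩ }
  let _ : Field S := hfield.toField
  let f : S →+* A := (RingHom.fst A A').comp S.subtype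
  let g : S →+* A' := (RingHom.snd A A').comp S.subtype
  have hfg : ∀ c, sign (f c) = sign (g c) := fun c => hS.prop _ c.2
  -- Both sides are treated in one induction on the degree, because comparing signs in degree n
  -- needs smaller-degree roots to be accounted for in `A` and in `A'`. A root is paired with one in
  -- the same cut, and adjoining the pair keeps sign compatibility, so the pair already lies in `S`.
  have hno : ∀ n, ∀ q : S[X], q ≠ 0 → q.natDegree = n →
      (∀ x, q.eval₂ f x = 0 → x ∈ Set.range f) ∧ (∀ y, q.eval₂ g y = 0 → y ∈ Set.range g) := by
    intro n
    induction n using Nat.strong_induction_on with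
    | h n ih =>
      intro q hq hqn
      have hf : RootsInRange f n := fun r hr hrn => (ih _ hrn r hr rfl).1
      have hg : RootsInRange g n := fun r hr hrn => (ih _ hrn r hr rfl).2
      have hmem : ∀ x y, q.eval₂ f x = 0 → q.eval₂ g y = 0 →
          (∀ c, sign (x - f c) = sign (y - g c)) → (x, y) ∈ S := by
        intro x y hx hy hxy
        have hn0 : q.natDegree ≠ 0 := by
          intro h0
          obtain ⟨c, rfl⟩ := natDegree_eq_zero.1 h0
          rw [eval₂_C, map_eq_zero] at hx
          simp [hx] at hq
        have hcomp : SignCompatible ((eval₂RingHom f x).prod (eval₂RingHom g y)).range := by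
          rintro _ ⟨r, rfl⟩
          exact sign_eval₂_eq_of_natDegree_le hfg hf hg hqn hn0 hx hy hxy r
        refine hS.le_of_ge hcomp (fun s hs => ⟨C ⟨s, hs⟩, ?_⟩) ⟨X, ?_⟩
        · simp [f, g]
        · simp
      constructor
      · intro x hx
        by_contra hxf
        obtain ⟨y, hy, hxy⟩ := exists_root_sameCut hfg hf hq hqn hx hxf
        exact hxf ⟨⟨_, hmem x y hx hy hxy⟩, rfl⟩
      · intro y hy
        by_contra hyg
        obtain ⟨x, hx, hxy⟩ := exists_root_sameCut (fun c => (hfg c).symm) hg hq hqn hy hyg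
        exact hyg ⟨⟨_, hmem x y hx hy fun c => (hxy c).symm⟩, rfl⟩
  obtain ⟨q, rfl⟩ := (mem_lifts (f := f) _).1 ((lifts_iff_coeff_lifts p).2 fun n => by
    obtain ⟨s, hs, h⟩ := hcoeff n
    exact ⟨⟨s, hs⟩, h⟩)
  rw [eval_map] at hα
  obtain ⟨s, hs⟩ := (hno _ q (by rintro rfl; simp at hp) rfl).1 α hα
  exact ⟨s, s.2, hs⟩

/-- If `β` and `β'` realize the same cut of the relatively algebraically closed subfield `k`, then
every cut of `k` realized in the real closure of `k(β)` is realized in the other extension. -/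
theorem exists_sign_sub_eq [IsStrictOrderedRing A] [IsRealClosed A]
    [IsStrictOrderedRing A'] [IsRealClosed A'] (hfg : ∀ c, sign (f c) = sign (g c))
    (hf : ∀ n, RootsInRange f n) (hg : ∀ n, RootsInRange g n) {β : A} {β' : A'}
    (hcut : ∀ c, sign (β - f c) = sign (β' - g c)) {α : A}
    (hα : α ∈ realClosureIn (Set.range f ∪ {β})) :
    ∃ α', ∀ c, sign (α - f c) = sign (α' - g c) := by
  have hS₀ : SignCompatible ((eval₂RingHom f β).prod (eval₂RingHom g β')).range := by
    rintro _ ⟨r, rfl⟩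
    exact sign_eval₂_eq hfg (hf _) (hg _) hcut r (Nat.lt_succ_self _)
  obtain ⟨S, hle, hS⟩ := exists_maximal_signCompatible hS₀
  have hdiag : ∀ c, (f c, g c) ∈ S := fun c => hle ⟨C c, by simp⟩
  have hβS : (β, β') ∈ S := hle ⟨X, by simp⟩
  obtain ⟨p, hp, hc, hpα⟩ := mem_realClosureIn_iff.1 hα
  have hcl : ∀ x ∈ Subfield.closure (Set.range f ∪ {β}), ∃ s ∈ S, s.1 = x := by
    intro x hx
    induction hx using Subfield.closure_induction with
    | mem x hx =>
      rcases hx with ⟨c, rfl⟩ | rfl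
      · exact ⟨_, hdiag c, rfl⟩
      · exact ⟨_, hβS, rfl⟩
    | one => exact ⟨1, one_mem _, rfl⟩
    | add x y _ _ h1 h2 =>
      obtain ⟨s, hs, rfl⟩ := h1
      obtain ⟨t, ht, rfl⟩ := h2
      exact ⟨s + t, add_mem hs ht, rfl⟩
    | neg x _ h1 =>
      obtain ⟨s, hs, rfl⟩ := h1
      exact ⟨-s, neg_mem hs, rfl⟩
    | inv x _ h1 =>
      obtain ⟨s, hs, rfl⟩ := h1
      by_cases h0 : s.1 = 0
      · exact ⟨0, zero_mem _, by simp [h0]⟩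
      · exact ⟨s⁻¹, inv_mem_of_maximal hS hs h0, rfl⟩
    | mul x y _ _ h1 h2 =>
      obtain ⟨s, hs, rfl⟩ := h1
      obtain ⟨t, ht, rfl⟩ := h2
      exact ⟨s * t, mul_mem hs ht, rfl⟩
  obtain ⟨s, hs, rfl⟩ := exists_mem_of_maximal hS hp (fun n => hcl _ (hc n)) hpα
  exact ⟨s.2, fun c => hS.prop _ (sub_mem hs (hdiag c))⟩

end Extension

/-! ### Transfer of cuts between two simple extensions inside one field -/

section SameCut

open SignType

variable {K : Type*} [Field K]

theorem sign_coe_subfield [LinearOrder K] {E : Subfield K} (x : E) : sign (x : K) = sign x := by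
  rcases lt_trichotomy x 0 with h | rfl | h
  · rw [sign_neg h, sign_neg (show (x : K) < 0 from h)]
  · simp
  · rw [sign_pos h, sign_pos (show 0 < (x : K) from h)]

theorem mem_closure_of_coe_mem {A : Subfield K} {S : Set A} {x : K}
    (hx : x ∈ Subfield.closure (Subtype.val '' S)) : ∃ y ∈ Subfield.closure S, (y : K) = x := by
  have h : Subfield.closure (A.subtype '' S) = (Subfield.closure S).map A.subtype :=
    (RingHom.map_field_closure A.subtype S).symm
  exact Subfield.mem_map.1 (h ▸ hx)

theorem mem_realClosureIn_of_coe_mem {A : Subfield K} {S : Set A} {x : A}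
    (hx : (x : K) ∈ realClosureIn (Subtype.val '' S)) : x ∈ realClosureIn S := by
  obtain ⟨p, hp, hc, hpx⟩ := mem_realClosureIn_iff.1 hx
  choose c hcS hcp using fun n => mem_closure_of_coe_mem (hc n)
  obtain ⟨q, rfl⟩ := (mem_lifts (f := A.subtype) _).1
    ((lifts_iff_coeff_lifts p).2 fun n => ⟨c n, hcp n⟩)
  refine mem_realClosureIn_iff.2 ⟨q, by rintro rfl; simp at hp, fun n => ?_, ?_⟩
  · have : q.coeff n = c n := Subtype.ext (by rw [hcp n, coeff_map]; rfl)
    rw [this]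
    exact hcS n
  · apply A.subtype.injective
    rw [map_zero, ← hpx, eval_map, ← eval₂_at_apply]
    rfl

theorem rootsInRange_inclusion {E : Set K} {A : Subfield K} (hE : realClosureIn E ≤ A) (n : ℕ) :
    RootsInRange (Subfield.inclusion hE) n := by
  intro p hp _ x hx
  refine ⟨⟨x, mem_realClosureIn_of_coeff_mem (p := p.map (realClosureIn E).subtype)
    (Polynomial.map_ne_zero hp) (fun n => by simp) ?_⟩, rfl⟩
  have h1 := congrArg A.subtype hx
  rw [hom_eval₂, map_zero] at h1
  rw [eval_map]
  exact h1

/-- If `b` and `b'` realize the same cut of the relatively algebraically closed subfield `E`, then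
every cut of `E` realized in the real closure of `E(b)` is realized in that of `E(b')`. -/
theorem exists_mem_realClosureIn_sameCut [LinearOrder K] [IsStrictOrderedRing K]
    [IsRealClosed K] {E : Set K} {b b' a : K} (hb : b ∉ realClosureIn E)
    (hb' : b' ∉ realClosureIn E) (hcut : ∀ e ∈ realClosureIn E, e < b ↔ e < b')
    (ha : a ∈ realClosureIn (E ∪ {b})) :
    ∃ a' ∈ realClosureIn (E ∪ {b'}), ∀ e ∈ realClosureIn E, sign (a - e) = sign (a' - e) := by
  obtain ⟨A, hA⟩ : ∃ A, A = realClosureIn (E ∪ {b}) := ⟨_, rfl⟩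
  obtain ⟨A', hA'⟩ : ∃ A', A' = realClosureIn (E ∪ {b'}) := ⟨_, rfl⟩
  have : IsRealClosed A := hA ▸ isRealClosed_realClosureIn (E ∪ {b})
  have : IsRealClosed A' := hA' ▸ isRealClosed_realClosureIn (E ∪ {b'})
  have hE : realClosureIn E ≤ A := hA ▸ realClosureIn_mono Set.subset_union_left
  have hE' : realClosureIn E ≤ A' := hA' ▸ realClosureIn_mono Set.subset_union_left
  have hbA : b ∈ A := hA ▸ subset_realClosureIn (by simp)
  have hbA' : b' ∈ A' := hA' ▸ subset_realClosureIn (by simp)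
  have haA : (⟨a, hA ▸ ha⟩ : A) ∈
      realClosureIn (Set.range (Subfield.inclusion hE) ∪ {⟨b, hbA⟩}) := by
    apply mem_realClosureIn_of_coe_mem
    have : Subtype.val '' (Set.range (Subfield.inclusion hE) ∪ {⟨b, hbA⟩})
        = (realClosureIn E : Set K) ∪ {b} := by
      rw [Set.image_union, ← Set.range_comp, Set.image_singleton]
      congr 1
      exact Subtype.range_coe
    rw [this, realClosureIn_union_left]
    exact ha
  obtain ⟨a', ha'⟩ := exists_sign_sub_eq (β' := (⟨b', hbA'⟩ : A'))
    (fun c => by rw [← sign_coe_subfield, ← sign_coe_subfield]; rfl)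
    (rootsInRange_inclusion hE) (rootsInRange_inclusion hE') (fun c => by
      rw [← sign_coe_subfield, ← sign_coe_subfield]
      change sign (b - (c : K)) = sign (b' - (c : K))
      have h1 : (c : K) ≠ b := fun h => hb (h ▸ c.2)
      have h2 : (c : K) ≠ b' := fun h => hb' (h ▸ c.2)
      have h3 := hcut c c.2
      rcases lt_or_gt_of_ne h1 with h | h
      · rw [sign_pos (sub_pos.2 h), sign_pos (sub_pos.2 (h3.1 h))]
      · have h' : b' < c := lt_of_le_of_ne (not_lt.1 fun h' => h.not_gt (h3.2 h')) h2.symm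
        rw [sign_neg (sub_neg.2 h), sign_neg (sub_neg.2 h')]) haA
  refine ⟨a', hA' ▸ a'.2, fun e he => ?_⟩
  have h := ha' ⟨e, he⟩
  rw [← sign_coe_subfield, ← sign_coe_subfield] at h
  exact h

end SameCut

variable {K : Type u} [Field K] [LinearOrder K] [IsStrictOrderedRing K]

/-! ### Extensions by independent cuts -/

section Independent

variable [IsRealClosed K] {F : Subfield K} {𝒞 : Set (Cut F)} {a : 𝒞 → K}

theorem IndependentCuts.not_realizes (h : IndependentCuts 𝒞)
    (ha : ∀ C : 𝒞, C.1.Realizes (fun x : F => (x : K)) (a C)) {s : Set 𝒞} {D : 𝒞} (hD : D ∉ s)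
    {b : K} (hb : b ∈ realClosureIn ((F : Set K) ∪ a '' s)) :
    ¬ D.1.Realizes (fun x : F => (x : K)) b := by
  let f : F →+*o K := { F.subtype with monotone' := fun _ _ h => h }
  have hmem : ∀ C : (Subtype.val '' s : Set (Cut F)), C.1 ∈ 𝒞 := by
    rintro ⟨_, C, _, rfl⟩
    exact C.2
  have := h (Subtype.val '' s) (by rintro _ ⟨C, _, rfl⟩; exact C.2) K f
    (fun C => a ⟨C.1, hmem C⟩) (fun C => ha ⟨C.1, hmem C⟩) D.1
    ⟨D.2, fun ⟨C, hC, hCD⟩ => hD (Subtype.ext hCD ▸ hC)⟩ b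
  refine this ?_
  convert hb using 3
  · exact Subtype.range_coe
  · ext y
    constructor
    · rintro ⟨⟨_, C, hC, rfl⟩, rfl⟩
      exact ⟨C, hC, rfl⟩
    · rintro ⟨C, hC, rfl⟩
      exact ⟨⟨_, C, hC, rfl⟩, rfl⟩

/-- Elements generated by disjoint sets `A`, `B` of realizations of independent cuts are separated
by elements generated by the common part `R`. -/
theorem IndependentCuts.exists_between (h : IndependentCuts 𝒞)
    (ha : ∀ C : 𝒞, C.1.Realizes (fun x : F => (x : K)) (a C)) (R A B : Finset 𝒞)
    (hAR : ∀ c ∈ A, c ∉ R) (hAB : ∀ c ∈ A, c ∉ B) {b b' : K} (hbb' : b ≤ b')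
    (hb : b ∈ realClosureIn ((F : Set K) ∪ a '' (↑R ∪ ↑A)))
    (hb' : b' ∈ realClosureIn ((F : Set K) ∪ a '' (↑R ∪ ↑B))) :
    ∃ e ∈ realClosureIn ((F : Set K) ∪ a '' ↑R), b ≤ e ∧ e ≤ b' := by
  classical
  induction A using Finset.induction_on generalizing b with
  | empty => exact ⟨b, by simpa using hb, le_rfl, hbb'⟩
  | insert c A hc ih =>
    have ih' := fun {b} => @ih (fun x hx => hAR x (Finset.mem_insert_of_mem hx))
      (fun x hx => hAB x (Finset.mem_insert_of_mem hx)) b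
    have hcR := hAR c (Finset.mem_insert_self c A)
    have hcB := hAB c (Finset.mem_insert_self c A)
    -- Otherwise b and b' fill the same cut of the real closure of `E`. Exchange puts `a c` into the
    -- real closure of E(b), so by transfer the cut `c` is realized in that of E(b'). This is
    -- generated without `a c`, against independence.
    by_contra hno
    set E : Set K := (F : Set K) ∪ a '' (↑R ∪ ↑A) with hE
    have hnoE : ∀ e ∈ realClosureIn E, ¬ (b ≤ e ∧ e ≤ b') := fun e he ⟨h1, h2⟩ => by
      obtain ⟨e', he', h3, h4⟩ := ih' h2 he
      exact hno ⟨e', he', h1.trans h3, h4⟩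
    have hbE : b ∉ realClosureIn E := fun hbE => hnoE b hbE ⟨le_rfl, hbb'⟩
    have hbE' : b' ∉ realClosureIn E := fun hbE => hnoE b' hbE ⟨hbb', le_rfl⟩
    have hcut : ∀ e ∈ realClosureIn E, e < b ↔ e < b' := fun e he =>
      ⟨fun h1 => h1.trans_le hbb', fun h1 => not_le.1 fun h2 => hnoE e he ⟨h2, h1.le⟩⟩
    have hins : (F : Set K) ∪ a '' (↑R ∪ ↑(insert c A)) = E ∪ {a c} := by
      rw [hE, Finset.coe_insert, Set.union_insert, Set.image_insert_eq, Set.union_assoc,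
        Set.union_singleton]
    rw [hins] at hb
    obtain ⟨a', ha', hsign⟩ := exists_mem_realClosureIn_sameCut hbE hbE' hcut
      (realClosureIn_exchange hb hbE)
    have hmem : a' ∈ realClosureIn ((F : Set K) ∪ a '' (↑R ∪ ↑A ∪ ↑B)) := by
      refine realClosureIn_le (Set.union_subset ?_ ?_) ha'
      · exact (Set.union_subset_union_right _
          (Set.image_mono Set.subset_union_left)).trans subset_realClosureIn
      · rw [Set.singleton_subset_iff]
        refine realClosureIn_mono (Set.union_subset_union_right _ (Set.image_mono ?_)) hb'
        exact Set.union_subset_union_left _ Set.subset_union_left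
    have hFE : ∀ x : F, (x : K) ∈ realClosureIn E := fun x =>
      subset_realClosureIn (Or.inl x.2)
    refine h.not_realizes ha (D := c) (s := ↑R ∪ ↑A ∪ ↑B) (by simp [hc, hcR, hcB]) hmem
      ⟨fun x hx => ?_, fun y hy => ?_⟩
    · have h1 := hsign x (hFE x)
      rw [sign_pos (sub_pos.2 ((ha c).1 x hx)), eq_comm, sign_eq_one_iff, sub_pos] at h1
      exact h1
    · have h1 := hsign y (hFE y)
      rw [sign_neg (sub_neg.2 ((ha c).2 y hy)), eq_comm, sign_eq_neg_one_iff, sub_neg] at h1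
      exact h1

variable {κ : Cardinal.{u}}

theorem exists_strictMono_mem_of_le_mk {J : Set κ.ord.ToType} (hJ : κ ≤ #J) :
    ∃ e : κ.ord.ToType → κ.ord.ToType, StrictMono e ∧ ∀ i, e i ∈ J := by
  refine exists_strictMono_of_not_noChain fun h => ?_
  exact (h J subset_rfl (Set.IsWF.of_wellFoundedLT J)).not_ge hJ

/-- Induction on the bound for the supports outside `R`. A cut occurring κ times moves into `R`,
which lowers the bound. If there is none, supports of late members are disjoint from that of `g i₀`,
and the separating element from the closure over `R` contradicts the choice of `i₀`. -/
theorem IndependentCuts.false_of_chain (hκ : κ.IsRegular) (hκ0 : ℵ₀ < κ)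
    (hF : NoChain κ (F : Set K)) (h : IndependentCuts 𝒞)
    (ha : ∀ C : 𝒞, C.1.Realizes (fun x : F => (x : K)) (a C)) (n : ℕ) (R : Finset 𝒞)
    {g : κ.ord.ToType → K} (hg : StrictMono g) {s : κ.ord.ToType → Finset 𝒞}
    (hs : ∀ i, (s i).card ≤ n)
    (hgs : ∀ i, g i ∈ realClosureIn ((F : Set K) ∪ a '' (↑R ∪ ↑(s i)))) : False := by
  classical
  have hNC : ∀ R : Finset 𝒞, NoChain κ (realClosureIn ((F : Set K) ∪ a '' ↑R) : Set K) := by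
    intro R
    have := noChain_realClosureIn_union_finset hκ hκ0 hF (R.image a)
    rwa [Finset.coe_image] at this
  induction n generalizing R g s with
  | zero =>
    have hlt := (hNC R).mk_lt_of_strictMonoOn (J := Set.univ) (g := g) (hg.strictMonoOn _)
      fun i _ => by
        have := hgs i
        rwa [Finset.card_eq_zero.1 (Nat.le_zero.1 (hs i)), Finset.coe_empty,
          Set.union_empty] at this
    rw [mk_univ, mk_ord_toType] at hlt
    exact lt_irrefl _ hlt
  | succ n ih =>
    by_cases hbig : ∃ c, κ ≤ #{i | c ∈ s i}
    · obtain ⟨c, hc⟩ := hbig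
      obtain ⟨e, he, hec⟩ := exists_strictMono_mem_of_le_mk hc
      refine ih (insert c R) (hg.comp he) (s := fun i => (s (e i)).erase c) (fun i => ?_)
        fun i => ?_
      · rw [Finset.card_erase_of_mem (hec i)]
        have := hs (e i)
        omega
      · refine realClosureIn_mono (Set.union_subset_union_right _ (Set.image_mono ?_)) (hgs (e i))
        intro x hx
        by_cases hxc : x = c
        · exact Or.inl (by simp [hxc])
        · rcases hx with hx | hx
          · exact Or.inl (by simpa using Or.inr hx)
          · exact Or.inr (by simpa [hxc] using hx)
    · push Not at hbig
      obtain ⟨i₀, hi₀⟩ := (hNC R).eventually_disjoint hκ hg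
      have hlt : #(⋃ c : s i₀, {i | c.1 ∈ s i}) < κ := by
        rw [card_iUnion_lt_iff_forall_of_isRegular hκ
          ((lt_aleph0_of_finite _).trans_le hκ.aleph0_le)]
        exact fun c => hbig c
      obtain ⟨i₁, hi₁⟩ := exists_forall_lt_of_mk_lt hκ hlt
      obtain ⟨i, hi, hi'⟩ := exists_gt_toType hκ i₀ i₁
      have hsdiff : ∀ t : Finset 𝒞, (↑R ∪ ↑(t \ R) : Set 𝒞) = ↑R ∪ ↑t := fun t => by
        rw [Finset.coe_sdiff, Set.union_sdiff_self]
      obtain ⟨e, he, h1, h2⟩ := h.exists_between ha R (s i₀ \ R) (s i \ R)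
        (fun c hc => (Finset.mem_sdiff.1 hc).2)
        (fun c hc hc' => lt_asymm hi' (hi₁ i (Set.mem_iUnion.2
          ⟨⟨c, (Finset.mem_sdiff.1 hc).1⟩, (Finset.mem_sdiff.1 hc').1⟩)))
        (hg hi).le (by rw [hsdiff]; exact hgs i₀) (by rw [hsdiff]; exact hgs i)
      exact hi₀ i hi.le e he ⟨h1, h2⟩

/-- Adjoining realizations of independent cuts does not create long chains. -/
theorem GeneratedByIndependentCuts.noChain (hκ : κ.IsRegular) (hκ0 : ℵ₀ < κ) {E : Subfield K}
    (h : GeneratedByIndependentCuts F E) (hF : NoChain κ (F : Set K)) :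
    NoChain κ (E : Set K) := by
  classical
  obtain ⟨𝒞, hind, a, ha, rfl⟩ := h
  by_contra hno
  obtain ⟨g, hg, hgE⟩ := exists_strictMono_of_not_noChain hno
  have hfin : ∀ i, ∃ s : Finset 𝒞, g i ∈ realClosureIn ((F : Set K) ∪ a '' ↑s) := by
    intro i
    obtain ⟨t, ht, hgt⟩ := exists_finset_of_mem_realClosureIn (hgE i)
    rw [← Set.image_univ] at ht
    obtain ⟨s, -, rfl⟩ := Finset.subset_set_image_iff.1 ht
    exact ⟨s, by rwa [Finset.coe_image] at hgt⟩
  choose s hs using hfin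
  obtain ⟨⟨n⟩, hn⟩ := infinite_pigeonhole_card (fun i => (ULift.up (s i).card : ULift.{u} ℕ)) κ
    (mk_ord_toType κ).ge hκ.aleph0_le (by
      rw [hκ.cof_ord]
      exact (mk_le_aleph0 (α := ULift.{u} ℕ)).trans_lt hκ0)
  obtain ⟨e, he, hen⟩ := exists_strictMono_mem_of_le_mk hn
  refine hind.false_of_chain hκ hκ0 hF ha n ∅ (hg.comp he) (s := fun i => s (e i))
    (fun i => ?_) fun i => ?_
  · exact (congrArg ULift.down (hen i)).le
  · simpa using hs (e i)

end Independent

/-! ### Towers -/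

section Tower

theorem countable_realClosureIn_empty (K : Type u) [Field K] :
    (realClosureIn (∅ : Set K) : Set K).Countable := by
  have h1 : Countable (Subfield.closure (∅ : Set K)) := by
    rw [← mk_le_aleph0_iff]
    exact (Subfield.cardinalMk_closure_le_max (∅ : Set K)).trans (by simp)
  have h2 := Algebra.IsAlgebraic.cardinalMk_le_max (Subfield.closure (∅ : Set K))
    (algebraicClosure (Subfield.closure (∅ : Set K)) K)
  have h3 := h2.trans (max_le (mk_le_aleph0_iff.2 h1) le_rfl)
  exact Set.countable_coe_iff.1 (mk_le_aleph0_iff.1 h3)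

/-- The cut of `F` realized by an element outside of `F`. -/
def cutOf (F : Subfield K) (x : K) (hx : x ∉ F) : Cut F where
  lower := {y | (y : K) < x}
  upper := {y | x < (y : K)}
  isCompl := by
    refine ⟨Set.disjoint_left.2 fun y h1 h2 => lt_asymm (α := K) h1 h2, ?_⟩
    refine codisjoint_iff.2 (Set.eq_univ_of_forall fun y => ?_)
    exact (lt_or_gt_of_ne (a := (y : K)) (b := x) (by rintro rfl; exact hx y.2)).imp id id
  lower_lt_upper := fun _ h1 _ h2 => lt_trans (α := K) h1 h2

/-- Only the empty subfamily is to be tested. Elements of `L` algebraic over the real closed `F` lie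
in `F`, and an element of `F` is on one side of the cut, so it cannot fill it. -/
theorem independentCuts_singleton {F : Type u} [Field F] [LinearOrder F] [IsStrictOrderedRing F]
    [IsRealClosed F] (C : Cut F) : IndependentCuts {C} := by
  intro 𝒞₀ h𝒞₀ L _ _ _ _ f a _ D hD b hb hreal
  have hemp : IsEmpty 𝒞₀ := ⟨fun C' => hD.2 (by
    rw [Set.mem_singleton_iff.1 hD.1, ← Set.mem_singleton_iff.1 (h𝒞₀ C'.2)]
    exact C'.2)⟩
  rw [Set.range_eq_empty a, Set.union_empty] at hb
  obtain ⟨p, hp, hc, hpb⟩ := mem_realClosureIn_iff.1 hb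
  have hcl : Subfield.closure (Set.range f) = (f : F →+* L).fieldRange :=
    Subfield.closure_eq_of_le (by rintro _ ⟨x, rfl⟩; exact ⟨x, rfl⟩) (by
      rintro _ ⟨x, rfl⟩; exact Subfield.subset_closure ⟨x, rfl⟩)
  rw [hcl] at hc
  obtain ⟨q, rfl⟩ := (mem_lifts (f := (f : F →+* L)) _).1 ((lifts_iff_coeff_lifts p).2 hc)
  rw [eval_map] at hpb
  obtain ⟨z, rfl⟩ := mem_range_of_eval₂_eq_zero (f : F →+* L)
    (by rintro rfl; simp at hp) hpb
  have hz : z ∈ D.lower ⊔ D.upper := by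
    rw [D.isCompl.sup_eq_top]
    trivial
  rcases hz with hz | hz
  · exact lt_irrefl _ (hreal.1 z hz)
  · exact lt_irrefl _ (hreal.2 z hz)

theorem generatedByIndependentCuts_insert [IsRealClosed K] (S : Set K) (x : K) :
    GeneratedByIndependentCuts (realClosureIn S) (realClosureIn (insert x S)) := by
  have hins : insert x S = S ∪ {x} := by rw [Set.union_singleton]
  by_cases hx : x ∈ realClosureIn S
  · refine ⟨∅, fun 𝒞₀ _ L _ _ _ _ f a _ D hD => absurd hD.1 (Set.notMem_empty D),
      fun C => absurd C.2 (Set.notMem_empty _), fun C => absurd C.2 (Set.notMem_empty _), ?_⟩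
    rw [Set.range_eq_empty, realClosureIn_union_left, Set.union_empty]
    refine le_antisymm (realClosureIn_le ?_) (realClosureIn_mono (Set.subset_insert _ _))
    exact Set.insert_subset hx subset_realClosureIn
  · have := isRealClosed_realClosureIn S
    refine ⟨{cutOf _ x hx}, independentCuts_singleton _, fun _ => x, ?_, ?_⟩
    · rintro ⟨C, rfl⟩
      exact ⟨fun _ h => h, fun _ h => h⟩
    · rw [Set.range_const, realClosureIn_union_left, hins]

/-- Every real closed field is the top of a tower. -/
theorem exists_isTower (K : Type u) [Field K] [LinearOrder K] [IsStrictOrderedRing K]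
    [IsRealClosed K] : ∃ α : Ordinal.{u}, ∃ T : Ordinal.{u} → Subfield K, IsTower K α T := by
  -- The generators are all elements of `K`, adjoined one at a time along a well-order, so each step
  -- uses at most one cut.
  let r : K → K → Prop := WellOrderingRel
  let e : K → Ordinal.{u} := fun x => Ordinal.typein r x
  refine ⟨Ordinal.type r, fun i => realClosureIn {x | e x < i}, ?_, ?_, ?_, ?_, ?_, ?_⟩
  · exact fun i _ => isRealClosed_realClosureIn _
  · exact fun i j hij _ => realClosureIn_mono fun x (hx : e x < i) =>
      show e x < j from hx.trans_le hij
  · intro i _ hi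
    apply Set.Subset.antisymm
    · intro x hx
      rw [SetLike.mem_coe, ← Set.empty_union {x | e x < i}] at hx
      obtain ⟨t, ht, hxt⟩ := exists_finset_of_mem_realClosureIn hx
      have hsup : t.sup (fun y => Order.succ (e y)) < i := by
        rw [Finset.sup_lt_iff hi.bot_lt]
        exact fun y hy => hi.succ_lt (ht hy)
      refine Set.mem_biUnion (x := t.sup (fun y => Order.succ (e y))) hsup ?_
      refine realClosureIn_mono (Set.union_subset (Set.empty_subset _) fun y hy => ?_) hxt
      exact (Order.lt_succ (e y)).trans_le
        (Finset.le_sup (f := fun y => Order.succ (e y)) hy)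
    · exact Set.iUnion₂_subset fun j hj =>
        realClosureIn_mono fun x (hx : e x < j) => show e x < i from hx.trans hj
  · convert countable_realClosureIn_empty K using 3
    simp
  · intro i hi
    obtain ⟨x, rfl⟩ := Ordinal.typein_surj r hi
    have : {y | e y < Order.succ (Ordinal.typein r x)} =
        insert x {y | e y < Ordinal.typein r x} := by
      ext y
      rw [Set.mem_ofPred_eq, Order.lt_succ_iff, le_iff_eq_or_lt, Set.mem_insert_iff,
        Set.mem_ofPred_eq, Ordinal.typein_inj r]
    rw [this]
    exact generatedByIndependentCuts_insert _ _
  · rw [eq_top_iff]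
    exact fun x _ => subset_realClosureIn (Ordinal.typein_lt_type r x)

theorem IsTower.noChain [IsRealClosed K] {κ : Cardinal.{u}} (hκ : κ.IsRegular) (hκ0 : ℵ₀ < κ)
    {α : Ordinal.{u}} (hα : α.card < κ) {T : Ordinal.{u} → Subfield K} (hT : IsTower K α T)
    {i : Ordinal.{u}} (hi : i ≤ α) : NoChain κ (T i : Set K) := by
  induction i using Ordinal.limitRecOn with
  | zero =>
    intro W hW _
    exact ((mk_le_aleph0_iff.2 (hT.countable.mono hW).to_subtype)).trans_lt hκ0
  | add_one i ih =>
    rw [← Order.succ_eq_add_one] at hi ⊢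
    have hi' : i < α := Order.succ_le_iff.1 hi
    exact (hT.step i hi').noChain hκ hκ0 (ih hi'.le)
  | limit i hlim ih =>
    intro W hW hWF
    rw [hT.continuous i hi hlim] at hW
    have hcover : W = ⋃ j : i.ToType, W ∩ T (Ordinal.typein (α := i.ToType) (· < ·) j) := by
      rw [← Set.inter_iUnion, eq_comm, Set.inter_eq_left]
      intro x hx
      obtain ⟨j, hj, hxj⟩ := Set.mem_iUnion₂.1 (hW hx)
      obtain ⟨k, rfl⟩ := Ordinal.typein_surj (α := i.ToType) (· < ·)
        (by rwa [Ordinal.type_toType])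
      exact Set.mem_iUnion.2 ⟨k, hxj⟩
    rw [hcover, card_iUnion_lt_iff_forall_of_isRegular hκ
      (by rw [mk_toType]; exact (Ordinal.card_le_card hi).trans_lt hα)]
    intro j
    have hj : Ordinal.typein (α := i.ToType) (· < ·) j < i := Ordinal.typein_lt_self j
    exact ih _ hj (hj.le.trans hi) _ Set.inter_subset_right (hWF.mono Set.inter_subset_left)

end Tower

/-! ### Regularity of the bound and the main theorem -/

theorem isRegular_heightPlus (K : Type u) [Field K] [LinearOrder K] :
    (heightPlus K).IsRegular := by
  unfold heightPlus
  rcases lt_or_ge (height K).card ℵ₀ with h | h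
  · rw [max_eq_right ((Order.succ_le_of_lt h).trans aleph0_lt_aleph_one.le)]
    exact isRegular_aleph_one
  · rw [max_eq_left]
    · exact isRegular_succ h
    · rw [← succ_aleph0]
      exact Order.succ_le_succ h

end HeightDepth

theorem mainTheorem4 (K : Type u) [Field K] [LinearOrder K] [IsStrictOrderedRing K]
    [IsRealClosed K] : HeightDepth.depth K ≤ HeightDepth.heightPlus K := by
  have hκ := HeightDepth.isRegular_heightPlus K
  have hκ0 : ℵ₀ < HeightDepth.heightPlus K := aleph0_lt_aleph_one.trans_le (le_max_right _ _)
  have hα : (HeightDepth.height K).card < HeightDepth.heightPlus K :=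
    (Order.lt_succ _).trans_le (le_max_left _ _)
  -- The existence of some tower is what makes the infimum defining the height attained.
  obtain ⟨T, hT⟩ : ∃ T, HeightDepth.IsTower K (HeightDepth.height K) T :=
    csInf_mem (HeightDepth.exists_isTower K)
  have hNC : HeightDepth.NoChain (HeightDepth.heightPlus K) (Set.univ : Set K) := by
    have := hT.noChain hκ hκ0 hα le_rfl
    rwa [hT.top] at this
  refine csInf_le' ⟨hκ, fun o ho => ?_⟩
  obtain ⟨s, hs⟩ := ho
  by_contra hle
  rw [not_lt] at hle
  let e := Ordinal.typein (α := (HeightDepth.heightPlus K).ord.ToType) (· < ·)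
  have hlt : ∀ i, e i < o := fun i => (Ordinal.typein_lt_self i).trans_le hle
  have := hNC.mk_lt_of_strictMonoOn (J := Set.univ) (g := fun i => s (e i))
    (fun i _ j _ hij => hs (hlt i) (hlt j) ((Ordinal.typein_lt_typein (· < ·)).2 hij))
    (fun _ _ => Set.mem_univ _)
  rw [mk_univ, mk_ord_toType] at this
  exact lt_irrefl _ this
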